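/- Use the Fourier transform $\hat g(\xi)=(2\pi)^{-1/2}\int_{\mathbb R} g(x)e^{-ix\xi}\,dx$, extended to tempered distributions. A real-valued, slowly increasing (locally integrable, of at most polynomial growth) function $\phi$ on $\mathbb R$ satisfies the *interpolating conditions* if its distributional Fourier transform agrees on $\mathbb R\setminus\{0\}$ with a function $\hat\phi\in C^1(\mathbb R\setminus\{0\})$ such that $\hat\phi\ge 0$, $\hat\phi\ge m$ on $[-\pi,\pi]\setminus\{0\}$ for some $m>0$, and, for some $\epsilon>0$, $\hat\phi(\xi)$ and $\hat\phi'(\xi)$ are $O(|\xi|^{-(1+\epsilon)})$ as $|\xi|\to\infty$. For $k\in\mathbb Z$ and $0<|u|\le\pi$ put $$\mathscr M[\hat\phi]_k(u)=\frac{\hat\phi(u+2\pi k)}{\hat\phi(u)},\qquad \mathscr M[\hat\phi']_k(u)=\frac{\hat\phi'(u+2\pi k)}{\hat\phi(u)} .$$ Let $A\subset(0,\infty)$ be unbounded. A family $\{\phi_\alpha:\alpha\in A\}$ is a *spline-like family of cardinal interpolators* if - (B1) every $\phi_\alpha$ satisfies the interpolating conditions; - (B2) there is a constant $C$ with $\sum_{j\in\mathbb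 Z}\sum_{k\ne j}\big\|\mathscr M[\hat\phi_\alpha]_j\,\mathscr M[\hat\phi_\alpha']_k\big\|_{L^1([-\pi,\pi])}\le C$ for all $\alpha\in A$; - (B3) for every $j\neq0$, $\lim_{\alpha\to\infty,\ \alpha\in A}\mathscr M[\hat\phi_\alpha]_j(\xi)=0$ for almost every $|\xi|\le\pi$; - (B4) there is a sequence $\{\mathscr M_j\}\in l^1(\mathbb Z)$ with $\mathscr M[\hat\phi_\alpha]_j(\xi)\le\mathscr M_j$ for all $j\ne0$, $\alpha\in A$ and $0<|\xi|\le\pi$. The *fundamental function* $L_{\phi_\alpha}(x)=(2\pi)^{-1/2}\int_{\mathbb R}\hat L_{\phi_\alpha}(\xi)e^{ix\xi}\,d\xi$ is given by $$\hat L_{\phi_\alpha}(\xi)=(2\pi)^{-1/2}\,\frac{\hat\phi_\alpha(\xi)}{\sum_{j\in\mathbb Z}\hat\phi_\alpha(\xi+2\pi j)},$$ and, for a sequence $f=\{f(j)\}_{j\in\mathbb Z}$ of complex numbers, $\mathscr I_{\phi_\alpha}[f](x)=\sum_{j\in\mathbb Z}f(j)L_{\phi_\alpha}(x-j)$. **Proposition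 1.** Let $\{\phi_\alpha:\alpha\in A\}$ be a spline-like family of cardinal interpolators and $1<p<\infty$. Then $\hat L_{\phi_\alpha}\in L^1(\mathbb R)$ for every $\alpha\in A$, and there is a constant $C_p$, independent of $f$ and of $\alpha$, such that for all $\alpha\in A$ and all $f\in l^p(\mathbb Z)$ the series defining $\mathscr I_{\phi_\alpha}[f](x)$ converges absolutely for every $x\in\mathbb R$, $\mathscr I_{\phi_\alpha}[f]\in L^p(\mathbb R)$, and $$\|\mathscr I_{\phi_\alpha}[f]\|_{L^p(\mathbb R)}\le C_p\,\|f\|_{l^p}.$$ -/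

import Mathlib

open scoped ENNReal NNReal

namespace CardinalInterpolation

noncomputable section

/-- The Fourier transform `(2π)^(-1/2) ∫ g(t) e^(-i x t) dt` of an integrable function. -/
def fourier (g : ℝ → ℂ) (x : ℝ) : ℂ :=
  ((Real.sqrt (2 * Real.pi))⁻¹ : ℂ) * ∫ t : ℝ, g t * Complex.exp (-(Complex.I * x * t))

/-- The inverse Fourier transform `(2π)^(-1/2) ∫ g(ξ) e^(i x ξ) dξ` of an integrable function. -/
def fourierInv (g : ℝ → ℂ) (x : ℝ) : ℂ :=
  ((Real.sqrt (2 * Real.pi))⁻¹ : ℂ) * ∫ ξ : ℝ, g ξ * Complex.exp (Complex.I * x * ξ)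

/-- A slowly increasing function: locally integrable and of at most polynomial growth. -/
def SlowlyIncreasing (φ : ℝ → ℝ) : Prop :=
  MeasureTheory.LocallyIntegrable φ ∧
    ∃ N : ℕ, φ =O[Filter.cocompact ℝ] fun x => |x| ^ N

/-- On `ℝ \ {0}` the Fourier transform of the tempered distribution `φ` is the function `F`:
`⟨φ, ĝ⟩ = ⟨F, g⟩` for all test functions `g` supported away from the origin. The origin is left
out because the transforms in question, such as `|ξ|^(-2k)`, may be singular there. If `F` is
continuous on `ℝ \ {0}`, then it is determined there by `φ`; the value `F 0` carries no meaning. -/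
def HasFourierTransform (φ F : ℝ → ℝ) : Prop :=
  ∀ g : ℝ → ℂ, ContDiff ℝ (⊤ : ℕ∞) g → HasCompactSupport g → (0 : ℝ) ∉ tsupport g →
    ∫ x : ℝ, (φ x : ℂ) * fourier g x = ∫ ξ : ℝ, (F ξ : ℂ) * g ξ

/-- `φ`, with Fourier transform `F`, satisfies the interpolating conditions. -/
structure InterpolatingConditions (φ F : ℝ → ℝ) : Prop where
  slowly_increasing : SlowlyIncreasing φ
  has_fourier : HasFourierTransform φ F
  nonneg : ∀ ξ : ℝ, ξ ≠ 0 → 0 ≤ F ξ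
  bounded_below : ∃ m : ℝ, 0 < m ∧ ∀ ξ ∈ Set.Icc (-Real.pi) Real.pi, ξ ≠ 0 → m ≤ F ξ
  contDiff : ContDiffOn ℝ 1 F {0}ᶜ
  decay : ∃ ε : ℝ, 0 < ε ∧
    F =O[Filter.cocompact ℝ] (fun ξ => |ξ| ^ (-(1 + ε))) ∧
    deriv F =O[Filter.cocompact ℝ] (fun ξ => |ξ| ^ (-(1 + ε)))

/-- The quotient `G(u + 2πk) / F(u)`. With `F` the Fourier transform of `φ`, the choices `G = F`
and `G = F'` give the auxiliary functions `𝓜[F]_k` and `𝓜[F']_k`. -/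
def aux (G F : ℝ → ℝ) (k : ℤ) (u : ℝ) : ℝ :=
  G (u + 2 * Real.pi * k) / F u

/-- `{φ α : α ∈ A}`, with Fourier transforms `F α`, is a spline-like family of cardinal
interpolators. -/
structure SplineLikeFamily (A : Set ℝ) (φ F : ℝ → ℝ → ℝ) : Prop where
  interpolating : ∀ α ∈ A, InterpolatingConditions (φ α) (F α)
  sum_bound : ∃ C : ℝ≥0, ∀ α ∈ A,
    ∑' j : ℤ, ∑' k : {k : ℤ // k ≠ j},
      ∫⁻ ξ in Set.Icc (-Real.pi) Real.pi,
        ‖aux (F α) (F α) j ξ * aux (deriv (F α)) (F α) k ξ‖ₑ ≤ (C : ℝ≥0∞)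
  tendsto_zero : ∀ j : ℤ, j ≠ 0 →
    ∀ᵐ ξ ∂(MeasureTheory.volume.restrict (Set.Icc (-Real.pi) Real.pi)),
      Filter.Tendsto (fun α => aux (F α) (F α) j ξ)
        (Filter.atTop ⊓ Filter.principal A) (nhds 0)
  dominated : ∃ M : ℤ → ℝ, Summable M ∧ ∀ j : ℤ, j ≠ 0 → ∀ α ∈ A,
    ∀ ξ ∈ Set.Icc (-Real.pi) Real.pi, ξ ≠ 0 → aux (F α) (F α) j ξ ≤ M j

/-- The Fourier transform of the fundamental function, in terms of the transform `F` of `φ`. -/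
def fundamentalHat (F : ℝ → ℝ) (ξ : ℝ) : ℝ :=
  (Real.sqrt (2 * Real.pi))⁻¹ * (F ξ / ∑' j : ℤ, F (ξ + 2 * Real.pi * j))

/-- The fundamental function `L_φ`, in terms of the transform `F` of `φ`. -/
def fundamental (F : ℝ → ℝ) (x : ℝ) : ℂ :=
  fourierInv (fun ξ => (fundamentalHat F ξ : ℂ)) x

/-- The interpolant `∑ j, f(j) L_φ(x - j)`. -/
def interpolant (F : ℝ → ℝ) (f : ℤ → ℂ) (x : ℝ) : ℂ :=
  ∑' j : ℤ, f j * fundamental F (x - j)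

end

end CardinalInterpolation

open scoped ENNReal NNReal
open MeasureTheory

namespace CardinalInterpolation

/-! The symbol `fundamentalHat F` is integrable and of bounded variation on ℝ apart from possible
jumps on 2πℤ, with bounds uniform in the family; a multiplier theorem then turns such bounds into
`ℓ^p → L^p` bounds.

Uniformity: let S be the periodization of F. The 2π-translates of F/S sum to 1, so the symbol has L¹
norm at most 2π. In the quotient rule the numerator `F'S - FS'`, expanded as a sum over translates,
loses its diagonal terms; since `S ≥ F(ξ)` for `|ξ| ≤ π`, what remains is dominated by the double
sum in (B2) (`InterpolatingConditions.enorm_deriv_fundamentalHat_le`).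

Multiplier theorem (`exists_eLpNorm_sum_fourierInv_le`): integration by parts on each cell between
consecutive multiples of 2π bounds the interpolant by an integral against `(|H| + |H'|) dt` of
partial integrals of `∑ f(j) exp(i(x-j)u)`. Up to a summable convolution kernel these are discrete
Hilbert transforms of modulations of f. Modulation preserves the `ℓ^p` norm, so Minkowski's
inequality finishes once the discrete M. Riesz theorem is known
(`exists_eLpNorm_count_cauchySum_le`).

M. Riesz theorem: for `1 < p ≤ 2` and nonnegative f, the Cauchy transform G has positive real part
in the upper half-plane, so `G^p` is holomorphic there and its integral over a horizontal line
vanishes. A pointwise inequality then controls `|G|^p` by `(Re G)^p`, a Poisson average of f.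
Exponents above 2 follow by duality. -/

/-! ### Minkowski and Young inequalities over the integers. -/

/-- A form of Minkowski's integral inequality, with values in `ℓ^q(ℤ)`. -/
lemma tsum_lintegral_rpow_le {T : Type*} [MeasurableSpace T] (ν : Measure T) {q : ℝ} (hq : 1 < q)
    (g : T → ℤ → ℝ≥0∞) (hg : ∀ n, AEMeasurable (fun t => g t n) ν) (M : ℝ≥0∞)
    (hM : ∀ t, ∑' n, g t n ^ q ≤ M ^ q) :
    ∑' n, (∫⁻ t, g t n ∂ν) ^ q ≤ (ν Set.univ * M) ^ q := by
  have hq0 : 0 < q := by linarith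
  have hpq : q.HolderConjugate (q / (q - 1)) := Real.HolderConjugate.conjExponent hq
  -- Hölder against the constant 1, which costs the power `q - 1` of the total mass.
  have key : ∀ n, (∫⁻ t, g t n ∂ν) ^ q ≤ ν Set.univ ^ (q - 1) * ∫⁻ t, g t n ^ q ∂ν := by
    intro n
    have h := ENNReal.lintegral_mul_le_Lp_mul_Lq ν hpq (hg n) (aemeasurable_const (b := (1 : ℝ≥0∞)))
    simp only [Pi.mul_apply, mul_one, ENNReal.one_rpow, lintegral_one] at h
    calc (∫⁻ t, g t n ∂ν) ^ q
        ≤ ((∫⁻ t, g t n ^ q ∂ν) ^ (1 / q) * ν Set.univ ^ (1 / (q / (q - 1)))) ^ q := by gcongr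
      _ = ν Set.univ ^ (q - 1) * ∫⁻ t, g t n ^ q ∂ν := by
        rw [ENNReal.mul_rpow_of_nonneg _ _ hq0.le, ← ENNReal.rpow_mul, ← ENNReal.rpow_mul,
          one_div_mul_cancel hq0.ne', ENNReal.rpow_one, mul_comm]
        congr 2
        have : q - 1 ≠ 0 := by linarith
        field_simp
  calc ∑' n, (∫⁻ t, g t n ∂ν) ^ q
      ≤ ∑' n, ν Set.univ ^ (q - 1) * ∫⁻ t, g t n ^ q ∂ν := ENNReal.tsum_le_tsum key
    _ = ν Set.univ ^ (q - 1) * ∫⁻ t, ∑' n, g t n ^ q ∂ν := by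
      rw [ENNReal.tsum_mul_left, lintegral_tsum fun n => (hg n).pow_const q]
    _ ≤ ν Set.univ ^ (q - 1) * ∫⁻ _, M ^ q ∂ν := by gcongr; exact hM _
    _ = (ν Set.univ * M) ^ q := by
      rw [lintegral_const, ENNReal.mul_rpow_of_nonneg _ _ hq0.le, mul_comm (M ^ q), ← mul_assoc]
      congr 1
      nth_rw 2 [← ENNReal.rpow_one (ν Set.univ)]
      rw [← ENNReal.rpow_add_of_nonneg _ _ (by linarith) zero_le_one]
      congr 1; ring

lemma eLpNorm_count_le_iff {E : Type*} [ENorm E] {p : ℝ≥0∞} (hp : 1 < p) (hp' : p < ∞)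
    (f : ℤ → E) (M : ℝ≥0∞) :
    eLpNorm f p Measure.count ≤ M ↔ ∑' n, ‖f n‖ₑ ^ p.toReal ≤ M ^ p.toReal := by
  have h0 : 0 < p.toReal := ENNReal.toReal_pos (by positivity) hp'.ne
  rw [eLpNorm_eq_lintegral_rpow_enorm_toReal (by positivity) hp'.ne, lintegral_count, one_div,
    ENNReal.rpow_inv_le_iff h0]

/-- The fibres of the floor are unit intervals, so functions of `⌊x⌋` have the same norm in `L^p(ℝ)`
as in `ℓ^p(ℤ)`. -/
lemma measurePreserving_floor :
    MeasurePreserving (Int.floor : ℝ → ℤ) volume Measure.count := by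
  refine ⟨Int.measurable_floor, Measure.ext_of_singleton fun n => ?_⟩
  rw [Measure.map_apply Int.measurable_floor (measurableSet_singleton n), Int.preimage_floor_singleton]
  simp

/-- The kernel `1 / (1 + n²)` on the integers. -/
noncomputable def decayKernel (n : ℤ) : ℝ := (1 + (n : ℝ) ^ 2)⁻¹

lemma decayKernel_pos (n : ℤ) : 0 < decayKernel n := by unfold decayKernel; positivity

lemma summable_decayKernel : Summable decayKernel := by
  have h1 : Summable fun n : ℤ => 1 / (n : ℝ) ^ 2 := by
    exact Real.summable_one_div_int_pow.mpr one_lt_two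
  refine Summable.of_norm_bounded_eventually h1 ?_
  filter_upwards [Filter.eventually_cofinite_ne (0 : ℤ)] with n hn
  rw [Real.norm_of_nonneg (decayKernel_pos n).le, decayKernel, ← one_div]
  have : (n : ℝ) ≠ 0 := by exact_mod_cast hn
  gcongr
  linarith

/-- Convolution of `|f|`, restricted to `s`, with `decayKernel`. -/
noncomputable def decaySum (s : Finset ℤ) (f : ℤ → ℂ) (n : ℤ) : ℝ :=
  ∑ j ∈ s, ‖f j‖ * decayKernel (n - j)

lemma decaySum_nonneg (s : Finset ℤ) (f : ℤ → ℂ) (n : ℤ) : 0 ≤ decaySum s f n :=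
  Finset.sum_nonneg fun _ _ => mul_nonneg (norm_nonneg _) (decayKernel_pos _).le

/-- Young's inequality for a summable kernel: Minkowski applied to the translates of f, with the
kernel as density. Restricting to `s` only drops nonnegative terms. -/
lemma exists_eLpNorm_decaySum_le {p : ℝ≥0∞} (hp : 1 < p) (hp' : p < ∞) :
    ∃ C : ℝ≥0, ∀ (s : Finset ℤ) (f : ℤ → ℂ),
      eLpNorm (decaySum s f) p Measure.count ≤ C * eLpNorm f p Measure.count := by
  have hq : 1 < p.toReal := by
    simpa using (ENNReal.toReal_lt_toReal ENNReal.one_ne_top hp'.ne).2 hp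
  have hsum : ∑' m : ℤ, ENNReal.ofReal (decayKernel m) ≠ ∞ :=
    summable_decayKernel.tsum_ofReal_ne_top
  refine ⟨(∑' m : ℤ, ENNReal.ofReal (decayKernel m)).toNNReal, fun s f => ?_⟩
  rw [ENNReal.coe_toNNReal hsum, eLpNorm_count_le_iff hp hp']
  set ν : Measure ℤ := Measure.count.withDensity fun m => ENNReal.ofReal (decayKernel m) with hν
  have hν1 : ν Set.univ = ∑' m : ℤ, ENNReal.ofReal (decayKernel m) := by
    rw [hν, withDensity_apply _ MeasurableSet.univ, Measure.restrict_univ, lintegral_count]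
  have hmain := tsum_lintegral_rpow_le ν hq (fun m n => ‖f (n - m)‖ₑ)
    (fun n => (measurable_of_countable _).aemeasurable) (eLpNorm f p Measure.count) (by
      intro m
      have h := (eLpNorm_count_le_iff hp hp' f _).1 le_rfl
      refine le_trans (le_of_eq ?_) h
      exact (Equiv.subRight m).tsum_eq fun n => ‖f n‖ₑ ^ p.toReal)
  rw [hν1] at hmain
  refine le_trans (ENNReal.tsum_le_tsum fun n => ?_) hmain
  gcongr
  rw [hν, lintegral_withDensity_eq_lintegral_mul _ (measurable_of_countable _)
    (measurable_of_countable _), lintegral_count, ← (Equiv.subLeft n).tsum_eq]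
  refine le_trans ?_ (ENNReal.sum_le_tsum s)
  rw [← ofReal_norm, Real.norm_of_nonneg (decaySum_nonneg s f n), decaySum,
    ENNReal.ofReal_sum_of_nonneg fun _ _ => mul_nonneg (norm_nonneg _) (decayKernel_pos _).le]
  refine Finset.sum_le_sum fun j _ => ?_
  rw [ENNReal.ofReal_mul (norm_nonneg _), ofReal_norm, mul_comm]
  simp [Equiv.subLeft]

/-! ### The M. Riesz inequality by contour integration. -/

/-- The pointwise inequality behind the M. Riesz theorem. -/
lemma exists_norm_rpow_le {q : ℝ} (hq : 1 < q) (hq' : q ≤ 2) :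
    ∃ A B : ℝ, 0 ≤ A ∧ 0 ≤ B ∧ ∀ z : ℂ, 0 < z.re →
      ‖z‖ ^ q ≤ A * z.re ^ q - B * (z ^ (q : ℂ)).re := by
  have hπ := Real.pi_pos
  -- The midpoint of `π/(2q)` and `π/2`. For `|arg z| ≥ θ` the angle `q|arg z|` lies between `qθ >
  -- π/2` and π, so `Re z^q` is negative enough; for `|arg z| < θ` the real part is at least `cos θ
  -- * ‖z‖`.
  set θ : ℝ := (Real.pi / (2 * q) + Real.pi / 2) / 2 with hθ
  have hqθ : q * θ = Real.pi / 4 + q * (Real.pi / 4) := by rw [hθ]; field_simp; ring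
  have hqθ1 : Real.pi / 2 < q * θ := by rw [hqθ]; nlinarith
  have hqθ2 : q * θ ≤ 3 * Real.pi / 4 := by rw [hqθ]; nlinarith
  have hθ0 : 0 < θ := by positivity
  have hθ1 : θ < Real.pi / 2 := by
    have : q * θ < q * (Real.pi / 2) := by rw [hqθ]; nlinarith
    exact lt_of_mul_lt_mul_left this (by linarith)
  set c := -Real.cos (q * θ) with hc
  have hc0 : 0 < c := by
    have := Real.cos_neg_of_pi_div_two_lt_of_lt hqθ1 (by linarith)
    linarith
  set d := Real.cos θ with hd
  have hd0 : 0 < d := Real.cos_pos_of_mem_Ioo ⟨by linarith, hθ1⟩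
  refine ⟨(1 + 1 / c) / d ^ q, 1 / c, by positivity, by positivity, fun z hz => ?_⟩
  have hr : 0 < ‖z‖ := hz.trans_le (Complex.re_le_norm z)
  have harg : |z.arg| < Real.pi / 2 := Complex.abs_arg_lt_pi_div_two_iff.2 (Or.inl hz)
  have hcos : 0 < Real.cos z.arg := Real.cos_pos_of_mem_Ioo (abs_lt.1 harg)
  have hre : z.re ^ q = ‖z‖ ^ q * Real.cos z.arg ^ q := by
    rw [← Real.mul_rpow hr.le hcos.le, Complex.norm_mul_cos_arg]
  have hcabs : Real.cos (z.arg * q) = Real.cos (q * |z.arg|) := by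
    rw [← Real.cos_abs (z.arg * q), abs_mul, abs_of_pos (by linarith : 0 < q), mul_comm]
  rw [Complex.cpow_ofReal_re, hre, hcabs]
  have hrq : 0 < ‖z‖ ^ q := by positivity
  rcases le_or_gt θ |z.arg| with h | h
  · have h1 : Real.cos (q * |z.arg|) ≤ -c := by
      rw [hc, neg_neg]
      exact Real.cos_le_cos_of_nonneg_of_le_pi (by positivity) (by nlinarith) (by gcongr)
    have h2 : ‖z‖ ^ q ≤ -(1 / c * (‖z‖ ^ q * Real.cos (q * |z.arg|))) := by
      have : 1 / c * (‖z‖ ^ q * Real.cos (q * |z.arg|)) ≤ 1 / c * (‖z‖ ^ q * (-c)) := by gcongr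
      have h3 : 1 / c * (‖z‖ ^ q * (-c)) = -‖z‖ ^ q := by field_simp
      linarith
    have h3 : 0 ≤ (1 + 1 / c) / d ^ q * (‖z‖ ^ q * Real.cos z.arg ^ q) := by positivity
    linarith
  · have h1 : d ≤ Real.cos z.arg := by
      rw [← Real.cos_abs z.arg]
      exact Real.cos_le_cos_of_nonneg_of_le_pi (abs_nonneg _) (by linarith) h.le
    have h2 : (1 + 1 / c) * ‖z‖ ^ q ≤ (1 + 1 / c) / d ^ q * (‖z‖ ^ q * Real.cos z.arg ^ q) := by
      have : (1 + 1 / c) / d ^ q * (‖z‖ ^ q * d ^ q)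
          ≤ (1 + 1 / c) / d ^ q * (‖z‖ ^ q * Real.cos z.arg ^ q) := by gcongr
      refine le_trans (le_of_eq ?_) this
      field_simp
    have h3 : 1 / c * (‖z‖ ^ q * Real.cos (q * |z.arg|)) ≤ 1 / c * (‖z‖ ^ q * 1) := by
      gcongr; exact Real.cos_le_one _
    linarith

/-- The Cauchy transform of the measure `∑ j ∈ s, f j • δ_j`, normalised to have positive real part
in the upper half-plane if `f` is positive. -/
noncomputable def cauchyTransform (s : Finset ℤ) (f : ℤ → ℝ) (z : ℂ) : ℂ :=
  ∑ j ∈ s, f j * (Complex.I / (z - j))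

lemma re_I_div_sub (z : ℂ) (j : ℤ) :
    (Complex.I / (z - j)).re = z.im / ((z.re - j) ^ 2 + z.im ^ 2) := by
  simp [Complex.div_re, Complex.normSq_apply]
  ring

lemma cauchyTransform_re (s : Finset ℤ) (f : ℤ → ℝ) (z : ℂ) :
    (cauchyTransform s f z).re = ∑ j ∈ s, f j * (z.im / ((z.re - j) ^ 2 + z.im ^ 2)) := by
  simp only [cauchyTransform, Complex.re_sum, Complex.re_ofReal_mul, re_I_div_sub]

lemma cauchyTransform_re_pos {s : Finset ℤ} {f : ℤ → ℝ} (hf : ∀ j ∈ s, 0 ≤ f j)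
    (hf' : ∃ j ∈ s, 0 < f j) {z : ℂ} (hz : 0 < z.im) : 0 < (cauchyTransform s f z).re := by
  rw [cauchyTransform_re]
  obtain ⟨j, hj, hj0⟩ := hf'
  exact Finset.sum_pos' (fun i hi => mul_nonneg (hf i hi) (by positivity))
    ⟨j, hj, by positivity⟩

lemma cauchyTransform_differentiableAt (s : Finset ℤ) (f : ℤ → ℝ) {z : ℂ} (hz : 0 < z.im) :
    DifferentiableAt ℂ (cauchyTransform s f) z := by
  unfold cauchyTransform
  refine DifferentiableAt.fun_sum fun j _ => ?_
  have : z - j ≠ 0 := fun h => by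
    have := congrArg Complex.im h
    simp at this; linarith
  fun_prop (disch := assumption)

lemma exists_norm_cauchyTransform_le (s : Finset ℤ) (f : ℤ → ℝ) :
    ∃ C R₀ : ℝ, 0 < C ∧ 0 < R₀ ∧ ∀ R ≥ R₀, ∀ z : ℂ, R ≤ ‖z‖ → ‖cauchyTransform s f z‖ ≤ C / R := by
  -- The radius exceeds `2|j|` for every `j ∈ s`, so `‖z - j‖ ≥ R/2`. The leading 1s only ensure
  -- positivity.
  refine ⟨1 + ∑ j ∈ s, |f j| * 2, 1 + 2 * ∑ j ∈ s, |(j : ℝ)|, by positivity, by positivity,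
    fun R hR z hz => ?_⟩
  have hR0 : 0 < R := lt_of_lt_of_le (by positivity) hR
  calc ‖cauchyTransform s f z‖ ≤ ∑ j ∈ s, |f j| * (2 / R) := by
        refine norm_sum_le_of_le _ fun j hj => ?_
        rw [norm_mul, norm_div, Complex.norm_I, Complex.norm_real, Real.norm_eq_abs]
        refine mul_le_mul_of_nonneg_left ?_ (abs_nonneg _)
        have h1 : |(j : ℝ)| ≤ ∑ j ∈ s, |(j : ℝ)| :=
          Finset.single_le_sum (f := fun j : ℤ => |(j : ℝ)|) (fun _ _ => abs_nonneg _) hj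
        have h2 : ‖z‖ - ‖(j : ℂ)‖ ≤ ‖z - j‖ := norm_sub_norm_le _ _
        rw [Complex.norm_intCast] at h2
        have h3 : R / 2 ≤ ‖z - j‖ := by linarith
        calc 1 / ‖z - j‖ ≤ 1 / (R / 2) := by gcongr
          _ = 2 / R := by field_simp
    _ ≤ (1 + ∑ j ∈ s, |f j| * 2) / R := by
        rw [add_div, Finset.sum_div]
        have : 0 ≤ 1 / R := by positivity
        simp only [mul_div_assoc]
        linarith

/-- Cauchy's theorem on the rectangle with corners `-R + i` and `R + iR`. -/
lemma norm_integral_cauchyTransform_cpow_le {s : Finset ℤ} {f : ℤ → ℝ} (hf : ∀ j ∈ s, 0 ≤ f j)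
    (hf' : ∃ j ∈ s, 0 < f j) {q : ℝ} (hq : 0 < q) {C R : ℝ} (hR : 1 ≤ R) (hC : 0 < C)
    (hG : ∀ z : ℂ, R ≤ ‖z‖ → ‖cauchyTransform s f z‖ ≤ C / R) :
    ‖∫ x : ℝ in -R..R, cauchyTransform s f (x + Complex.I) ^ (q : ℂ)‖ ≤ 4 * R * (C / R) ^ q := by
  set G : ℂ → ℂ := fun z => cauchyTransform s f z ^ (q : ℂ) with hGdef
  have hbound : ∀ z : ℂ, R ≤ ‖z‖ → ‖G z‖ ≤ (C / R) ^ q := by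
    intro z hz
    rw [hGdef, Complex.norm_cpow_real]
    exact Real.rpow_le_rpow (norm_nonneg _) (hG z hz) hq.le
  have hd : DifferentiableOn ℂ G (Set.uIcc (-R) R ×ℂ Set.uIcc 1 R) := by
    intro z hz
    have him : 0 < z.im := by
      have := hz.2
      rw [Set.mem_preimage, Set.uIcc_of_le hR] at this
      linarith [this.1]
    exact ((cauchyTransform_differentiableAt s f him).cpow_const
      (Or.inl (cauchyTransform_re_pos hf hf' him))).differentiableWithinAt
  have hrect := Complex.integral_boundary_rect_eq_zero_of_differentiableOn G
    ⟨-R, 1⟩ ⟨R, R⟩ hd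
  simp only [Complex.ofReal_one, one_mul, smul_eq_mul] at hrect
  -- The top and the two vertical sides stay at distance at least R from the origin and have total
  -- length `2R + 2(R - 1) ≤ 4R`.
  have htop : ‖∫ x : ℝ in -R..R, G (x + R * Complex.I)‖ ≤ (C / R) ^ q * |R - -R| := by
    refine intervalIntegral.norm_integral_le_of_norm_le_const fun x _ => hbound _ ?_
    refine le_trans ?_ (Complex.abs_im_le_norm _)
    simp [le_abs_self]
  have hright : ‖∫ y : ℝ in (1:ℝ)..R, G ((R : ℝ) + y * Complex.I)‖ ≤ (C / R) ^ q * |R - 1| := by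
    refine intervalIntegral.norm_integral_le_of_norm_le_const fun x _ => hbound _ ?_
    refine le_trans ?_ (Complex.abs_re_le_norm _)
    simp [le_abs_self]
  have hleft : ‖∫ y : ℝ in (1:ℝ)..R, G ((-R : ℝ) + y * Complex.I)‖ ≤ (C / R) ^ q * |R - 1| := by
    refine intervalIntegral.norm_integral_le_of_norm_le_const fun x _ => hbound _ ?_
    refine le_trans ?_ (Complex.abs_re_le_norm _)
    simp [le_abs_self]
  have heq : ∫ x : ℝ in -R..R, G (x + Complex.I) = (∫ x : ℝ in -R..R, G (x + R * Complex.I))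
      - Complex.I * (∫ y : ℝ in (1:ℝ)..R, G ((R : ℝ) + y * Complex.I))
      + Complex.I * (∫ y : ℝ in (1:ℝ)..R, G ((-R : ℝ) + y * Complex.I)) := by
    linear_combination hrect
  have hp : 0 ≤ (C / R) ^ q := by positivity
  rw [abs_of_nonneg (by linarith)] at htop hright hleft
  change ‖∫ x : ℝ in -R..R, G (x + Complex.I)‖ ≤ _
  rw [heq]
  refine (norm_add_le_of_le (norm_sub_le_of_le htop ?_) ?_).trans (b := (C / R) ^ q * (R - -R) +
    (C / R) ^ q * (R - 1) + (C / R) ^ q * (R - 1)) ?_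
  · rw [norm_mul, Complex.norm_I, one_mul]; exact hright
  · rw [norm_mul, Complex.norm_I, one_mul]; exact hleft
  · nlinarith

/-- Integrating the pointwise inequality along `Im z = 1` leaves only the real part, because the
integral of `G^q` tends to 0 by Cauchy's theorem. -/
lemma exists_lintegral_cauchyTransform_le {q : ℝ} (hq : 1 < q) (hq' : q ≤ 2) :
    ∃ A : ℝ≥0, ∀ (s : Finset ℤ) (f : ℤ → ℝ), (∀ j ∈ s, 0 ≤ f j) →
      ∫⁻ x : ℝ, ‖cauchyTransform s f (x + Complex.I)‖ₑ ^ q ≤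
        A * ∫⁻ x : ℝ, ‖(cauchyTransform s f (x + Complex.I)).re‖ₑ ^ q := by
  obtain ⟨A, B, hA, hB, hAB⟩ := exists_norm_rpow_le hq hq'
  have hq0 : 0 < q := by linarith
  refine ⟨A.toNNReal, fun s f hf => ?_⟩
  -- Without a positive coefficient the transform is zero. Otherwise its real part is strictly
  -- positive, which keeps it off the branch cut of `z^q`.
  by_cases hf' : ∃ j ∈ s, 0 < f j
  swap
  · have hz : ∀ z, cauchyTransform s f z = 0 := fun z => Finset.sum_eq_zero fun j hj => by
      have : f j = 0 := le_antisymm (not_lt.1 fun h => hf' ⟨j, hj, h⟩) (hf j hj)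
      simp [this]
    simp [hz, hq0]
  obtain ⟨C, R₀, hC, hR₀, hCR⟩ := exists_norm_cauchyTransform_le s f
  set G : ℝ → ℂ := fun x => cauchyTransform s f (x + Complex.I) with hG
  have hGre : ∀ x, 0 < (G x).re := fun x => cauchyTransform_re_pos hf hf' (by simp)
  have hGc : Continuous G := by
    rw [continuous_iff_continuousAt]
    intro x
    have h1 := (cauchyTransform_differentiableAt s f (z := x + Complex.I) (by simp)).continuousAt
    exact ContinuousAt.comp (f := fun x : ℝ => (x : ℂ) + Complex.I) h1 (by fun_prop)
  have hc1 : Continuous fun x => ‖G x‖ ^ q :=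
    hGc.norm.rpow_const fun _ => Or.inr hq0.le
  have hc2 : Continuous fun x => (G x).re ^ q :=
    (Complex.continuous_re.comp hGc).rpow_const fun _ => Or.inr hq0.le
  have hc3 : Continuous fun x => G x ^ (q : ℂ) := by
    rw [continuous_iff_continuousAt]
    exact fun x => hGc.continuousAt.cpow continuousAt_const (Or.inl (hGre x))
  have hR : ∀ R : ℝ, max 1 R₀ ≤ R → ∫⁻ x in Set.Ioc (-R) R, ‖G x‖ₑ ^ q ≤
      A.toNNReal * (∫⁻ x : ℝ, ‖(G x).re‖ₑ ^ q) + ENNReal.ofReal (B * (4 * R * (C / R) ^ q)) := by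
    intro R hR
    have hR1 : 1 ≤ R := (le_max_left _ _).trans hR
    have hneg : -R ≤ R := by linarith
    have hint := norm_integral_cauchyTransform_cpow_le hf hf' hq0 hR1 hC
      (hCR R ((le_max_right _ _).trans hR))
    have h1 : ∫ x in -R..R, ‖G x‖ ^ q ≤
        A * (∫ x in -R..R, (G x).re ^ q) + B * (4 * R * (C / R) ^ q) := by
      calc ∫ x in -R..R, ‖G x‖ ^ q
          ≤ ∫ x in -R..R, (A * (G x).re ^ q - B * (G x ^ (q : ℂ)).re) := by
            refine intervalIntegral.integral_mono_on hneg (hc1.intervalIntegrable _ _)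
              (Continuous.intervalIntegrable ?_ _ _) fun x _ => hAB _ (hGre x)
            exact (hc2.const_mul A).sub ((Complex.continuous_re.comp hc3).const_mul B)
        _ = A * (∫ x in -R..R, (G x).re ^ q) - B * (∫ x in -R..R, G x ^ (q : ℂ)).re := by
            rw [intervalIntegral.integral_sub, intervalIntegral.integral_const_mul,
              intervalIntegral.integral_const_mul]
            · congr 2
              have := Complex.reCLM.intervalIntegral_comp_comm (hc3.intervalIntegrable (μ := volume) (-R) R)
              simpa using this
            · exact (hc2.const_mul A).intervalIntegrable _ _
            · exact ((Complex.continuous_re.comp hc3).const_mul B).intervalIntegrable _ _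
        _ ≤ _ := by
            have h2 := (Complex.abs_re_le_norm _).trans hint
            have h3 := neg_le_of_abs_le h2
            nlinarith
    have e1 : ∫⁻ x in Set.Ioc (-R) R, ‖G x‖ₑ ^ q = ENNReal.ofReal (∫ x in -R..R, ‖G x‖ ^ q) := by
      rw [intervalIntegral.integral_of_le hneg, ofReal_integral_eq_lintegral_ofReal
        (hc1.intervalIntegrable (-R) R).1 (Filter.Eventually.of_forall fun x => by positivity)]
      refine lintegral_congr fun x => ?_
      rw [← ofReal_norm, ENNReal.ofReal_rpow_of_nonneg (norm_nonneg _) hq0.le]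
    have e2 : ENNReal.ofReal (∫ x in -R..R, (G x).re ^ q) ≤ ∫⁻ x : ℝ, ‖(G x).re‖ₑ ^ q := by
      rw [intervalIntegral.integral_of_le hneg, ofReal_integral_eq_lintegral_ofReal
        (hc2.intervalIntegrable (-R) R).1
        (Filter.Eventually.of_forall fun x => Real.rpow_nonneg (hGre x).le _)]
      refine le_trans (le_of_eq ?_) (setLIntegral_le_lintegral (Set.Ioc (-R) R) _)
      refine lintegral_congr fun x => ?_
      rw [← ofReal_norm, ENNReal.ofReal_rpow_of_nonneg (norm_nonneg _) hq0.le,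
        Real.norm_of_nonneg (hGre x).le]
    have hpos : 0 ≤ ∫ x in -R..R, (G x).re ^ q :=
      intervalIntegral.integral_nonneg hneg fun x _ => Real.rpow_nonneg (hGre x).le _
    rw [e1]
    refine (ENNReal.ofReal_le_ofReal h1).trans ?_
    rw [ENNReal.ofReal_add (by positivity) (by positivity), ENNReal.ofReal_mul hA]
    gcongr
    exact le_rfl
  have hcover : AECover volume Filter.atTop fun R : ℝ => Set.Ioc (-R) R :=
    aecover_Ioc Filter.tendsto_neg_atTop_atBot Filter.tendsto_id
  have hlim := hcover.lintegral_tendsto_of_countably_generated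
    (f := fun x => ‖G x‖ₑ ^ q) (by fun_prop)
  -- The contour error is of order `R^(1 - q)`; this uses `q > 1`.
  have hlim2 : Filter.Tendsto (fun R : ℝ => ENNReal.ofReal (B * (4 * R * (C / R) ^ q)))
      Filter.atTop (nhds 0) := by
    rw [← ENNReal.ofReal_zero]
    refine (ENNReal.continuous_ofReal.tendsto 0).comp ?_
    have h1 : Filter.Tendsto (fun R : ℝ => B * 4 * C ^ q * R ^ (-(q - 1))) Filter.atTop (nhds 0) := by
      simpa using (tendsto_rpow_neg_atTop (by linarith : 0 < q - 1)).const_mul (B * 4 * C ^ q)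
    refine h1.congr' ?_
    filter_upwards [Filter.eventually_gt_atTop 0] with R hR
    rw [Real.div_rpow hC.le hR.le, neg_sub, Real.rpow_sub hR, Real.rpow_one]
    field_simp
  have hlim3 := hlim2.const_add (A.toNNReal * (∫⁻ x : ℝ, ‖(G x).re‖ₑ ^ q))
  rw [add_zero] at hlim3
  exact le_of_tendsto_of_tendsto hlim hlim3
    ((Filter.eventually_ge_atTop (max 1 R₀)).mono hR)

/-! ### The discrete Hilbert transform on `ℓ^p`. -/

/-- The sum `∑ j ∈ s, f j / (x - j + i)`, a regularised Hilbert transform of `f`. -/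
noncomputable def cauchySum (s : Finset ℤ) (f : ℤ → ℂ) (x : ℝ) : ℂ :=
  ∑ j ∈ s, f j * ((x : ℂ) - j + Complex.I)⁻¹

lemma sub_add_I_ne_zero (x : ℝ) (j : ℤ) : (x : ℂ) - j + Complex.I ≠ 0 := fun h => by
  have := congrArg Complex.im h
  simp at this

lemma norm_sub_add_I_sq (x : ℝ) (j : ℤ) : ‖(x : ℂ) - j + Complex.I‖ ^ 2 = 1 + (x - j) ^ 2 := by
  rw [← Complex.normSq_eq_norm_sq, Complex.normSq_apply]
  simp; ring

lemma one_le_norm_sub_add_I (x : ℝ) (j : ℤ) : 1 ≤ ‖(x : ℂ) - j + Complex.I‖ := by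
  refine le_trans ?_ (Complex.abs_im_le_norm _)
  simp

lemma continuous_cauchySum (s : Finset ℤ) (f : ℤ → ℂ) : Continuous (cauchySum s f) := by
  refine continuous_finsetSum _ fun j _ => continuous_const.mul ?_
  exact (by fun_prop : Continuous fun x : ℝ => (x : ℂ) - j + Complex.I).inv₀
    fun x => sub_add_I_ne_zero x j

lemma cauchyTransform_add_I (s : Finset ℤ) (f : ℤ → ℝ) (x : ℝ) :
    cauchyTransform s f (x + Complex.I) = Complex.I * cauchySum s (fun j => f j) x := by
  rw [cauchyTransform, cauchySum, Finset.mul_sum]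
  refine Finset.sum_congr rfl fun j _ => ?_
  rw [div_eq_mul_inv, show (x : ℂ) + Complex.I - j = x - j + Complex.I by ring]
  ring

/-- Moving a point to its integer part changes the weight `1 + (x - j)²` by a bounded factor. -/
lemma inv_one_add_sq_le (x : ℝ) (j : ℤ) : (1 + (x - j) ^ 2)⁻¹ ≤ 3 * decayKernel (⌊x⌋ - j) := by
  rw [decayKernel, ← div_eq_mul_inv, inv_eq_one_div, div_le_div_iff₀ (by positivity) (by positivity)]
  push_cast
  have h1 := Int.floor_le x
  have h2 := Int.lt_floor_add_one x
  -- With u = x - j and v the fractional part of x: `(u - v)² ≤ 2u² + 2v²` and `v < 1`.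
  nlinarith [sq_nonneg ((x - j) + (x - ⌊x⌋))]

/-- The real part at height 1 is a sum of Poisson kernels, comparable with `decayKernel`. -/
lemma cauchyTransform_re_add_I_le {s : Finset ℤ} {f : ℤ → ℝ} (x : ℝ) :
    ‖(cauchyTransform s f (x + Complex.I)).re‖ ≤ 3 * decaySum s (fun j => f j) ⌊x⌋ := by
  rw [cauchyTransform_re, decaySum, Finset.mul_sum]
  refine norm_sum_le_of_le _ fun j _ => ?_
  have h := inv_one_add_sq_le x j
  simp only [Complex.add_re, Complex.ofReal_re, Complex.I_re, add_zero, Complex.add_im,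
    Complex.ofReal_im, Complex.I_im, zero_add, one_pow, one_div]
  rw [norm_mul, Complex.norm_real, Real.norm_of_nonneg (by positivity : 0 ≤ ((x - j) ^ 2 + 1)⁻¹),
    add_comm ((x - j) ^ 2)]
  calc ‖f j‖ * (1 + (x - j) ^ 2)⁻¹ ≤ ‖f j‖ * (3 * decayKernel (⌊x⌋ - j)) := by gcongr
    _ = _ := by ring

lemma one_lt_toReal {p : ℝ≥0∞} (hp : 1 < p) (hp' : p < ∞) : 1 < p.toReal := by
  simpa using (ENNReal.toReal_lt_toReal ENNReal.one_ne_top hp'.ne).2 hp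

lemma eLpNorm_comp_floor {E : Type*} [TopologicalSpace E] [ContinuousENorm E]
    [TopologicalSpace.PseudoMetrizableSpace E] (g : ℤ → E)
    (p : ℝ≥0∞) : eLpNorm (fun x : ℝ => g ⌊x⌋) p = eLpNorm g p Measure.count :=
  eLpNorm_comp_measurePreserving (g := g) StronglyMeasurable.of_discrete.aestronglyMeasurable measurePreserving_floor

/-- The M. Riesz theorem for nonnegative sequences and `1 < p ≤ 2`. -/
lemma exists_eLpNorm_cauchySum_le_of_nonneg {p : ℝ≥0∞} (hp : 1 < p) (hp2 : p ≤ 2) :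
    ∃ C : ℝ≥0, ∀ (s : Finset ℤ) (f : ℤ → ℝ), (∀ j, 0 ≤ f j) →
      eLpNorm (cauchySum s (fun j => f j)) p ≤
        C * eLpNorm (fun j => (f j : ℂ)) p Measure.count := by
  have hp' : p < ∞ := hp2.trans_lt (by simp)
  have hq := one_lt_toReal hp hp'
  have hq0 : 0 < p.toReal := by linarith
  have hq2 : p.toReal ≤ 2 := ENNReal.toReal_mono (by simp) hp2
  obtain ⟨A, hA⟩ := exists_lintegral_cauchyTransform_le hq hq2
  obtain ⟨B, hB⟩ := exists_eLpNorm_decaySum_le hp hp'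
  refine ⟨A ^ (1 / p.toReal) * (3 * B), fun s f hf => ?_⟩
  have hp0 : p ≠ 0 := by positivity
  have h1 : eLpNorm (cauchySum s (fun j => f j)) p ≤ (A : ℝ≥0∞) ^ (1 / p.toReal) *
      eLpNorm (fun x : ℝ => (cauchyTransform s f (x + Complex.I)).re) p := by
    rw [eLpNorm_eq_lintegral_rpow_enorm_toReal hp0 hp'.ne,
      eLpNorm_eq_lintegral_rpow_enorm_toReal hp0 hp'.ne,
      ← ENNReal.mul_rpow_of_nonneg _ _ (by positivity)]
    refine ENNReal.rpow_le_rpow (le_trans (le_of_eq ?_) (hA s f fun j _ => hf j)) (by positivity)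
    refine lintegral_congr fun x => ?_
    rw [cauchyTransform_add_I, enorm_mul]
    simp [enorm_eq_nnnorm]
  have h2 : eLpNorm (fun x : ℝ => (cauchyTransform s f (x + Complex.I)).re) p ≤
      3 * eLpNorm (decaySum s (fun j => f j)) p Measure.count := by
    have := eLpNorm_le_mul_eLpNorm_of_ae_le_mul (μ := volume)
      (f := fun x : ℝ => (cauchyTransform s f (x + Complex.I)).re)
      (g := fun x : ℝ => decaySum s (fun j => f j) ⌊x⌋) (c := 3) (Filter.Eventually.of_forall
      fun x => by
        rw [Real.norm_of_nonneg (decaySum_nonneg _ _ _)]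
        exact cauchyTransform_re_add_I_le x) p
    rwa [eLpNorm_comp_floor, ENNReal.ofReal_ofNat] at this
  have hB' := hB s fun j => f j
  calc _ ≤ (A : ℝ≥0∞) ^ (1 / p.toReal) * (3 * (B * eLpNorm (fun j => (f j : ℂ)) p Measure.count)) :=
        h1.trans (by gcongr; exact h2.trans (by gcongr))
    _ = _ := by
      rw [ENNReal.coe_mul, ENNReal.coe_mul, ENNReal.coe_rpow_of_nonneg _ (by positivity)]
      simp only [ENNReal.coe_ofNat]
      ring

/-- Linearity: the positive and negative parts of `re` and `im` are each dominated by `‖f‖`, whence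
the factor 4. -/
lemma exists_eLpNorm_cauchySum_le_of_le_two {p : ℝ≥0∞} (hp : 1 < p) (hp2 : p ≤ 2) :
    ∃ C : ℝ≥0, ∀ (s : Finset ℤ) (f : ℤ → ℂ),
      eLpNorm (cauchySum s f) p ≤ C * eLpNorm f p Measure.count := by
  obtain ⟨C, hC⟩ := exists_eLpNorm_cauchySum_le_of_nonneg hp hp2
  refine ⟨4 * C, fun s f => ?_⟩
  have hpart : ∀ g : ℤ → ℝ, (∀ j, 0 ≤ g j) → (∀ j, g j ≤ ‖f j‖) →
      eLpNorm (cauchySum s (fun j => g j)) p ≤ C * eLpNorm f p Measure.count := by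
    intro g hg hgf
    refine (hC s g hg).trans ?_
    gcongr
    refine eLpNorm_mono fun j => ?_
    rw [Complex.norm_real, Real.norm_of_nonneg (hg j)]
    exact hgf j
  have b1 := hpart (fun j => max (f j).re 0) (fun j => le_max_right _ _)
    (fun j => max_le (Complex.re_le_norm _) (norm_nonneg _))
  have b2 := hpart (fun j => max (-(f j).re) 0) (fun j => le_max_right _ _)
    (fun j => max_le ((neg_le_abs _).trans (Complex.abs_re_le_norm _)) (norm_nonneg _))
  have b3 := hpart (fun j => max (f j).im 0) (fun j => le_max_right _ _)
    (fun j => max_le (Complex.im_le_norm _) (norm_nonneg _))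
  have b4 := hpart (fun j => max (-(f j).im) 0) (fun j => le_max_right _ _)
    (fun j => max_le ((neg_le_abs _).trans (Complex.abs_im_le_norm _)) (norm_nonneg _))
  set g₁ := cauchySum s fun j => (max (f j).re 0 : ℝ)
  set g₂ := cauchySum s fun j => (max (-(f j).re) 0 : ℝ)
  set g₃ := cauchySum s fun j => (max (f j).im 0 : ℝ)
  set g₄ := cauchySum s fun j => (max (-(f j).im) 0 : ℝ)
  have hdecomp : cauchySum s f = (g₁ - g₂) + Complex.I • (g₃ - g₄) := by
    funext x
    simp only [g₁, g₂, g₃, g₄, Pi.add_apply, Pi.sub_apply, Pi.smul_apply, smul_eq_mul, cauchySum,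
      ← Finset.sum_sub_distrib, Finset.mul_sum, ← Finset.sum_add_distrib]
    refine Finset.sum_congr rfl fun j _ => ?_
    have e : ∀ a : ℝ, max a 0 - max (-a) 0 = a := fun a => by
      rcases le_total 0 a with h | h <;> simp [h]
    have hfj : f j = ((max (f j).re 0 : ℝ) - (max (-(f j).re) 0 : ℝ)) +
        Complex.I * ((max (f j).im 0 : ℝ) - (max (-(f j).im) 0 : ℝ)) := by
      rw [← Complex.ofReal_sub, ← Complex.ofReal_sub, e, e, mul_comm, Complex.re_add_im]
    nth_rw 1 [hfj]
    ring
  have m : ∀ g, AEStronglyMeasurable (cauchySum s g) (volume : Measure ℝ) :=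
    fun g => (continuous_cauchySum s g).aestronglyMeasurable
  rw [hdecomp]
  have h1 := eLpNorm_add_le ((m _).sub (m _)) (((m _).sub (m _)).const_smul Complex.I) hp.le
    (f := g₁ - g₂) (g := Complex.I • (g₃ - g₄))
  have h2 := eLpNorm_sub_le (m _) (m _) hp.le (f := g₁) (g := g₂)
  have h3 := eLpNorm_sub_le (m _) (m _) hp.le (f := g₃) (g := g₄)
  have h4 : eLpNorm (Complex.I • (g₃ - g₄)) p volume = eLpNorm (g₃ - g₄) p volume := by
    rw [eLpNorm_const_smul]; simp [enorm_eq_nnnorm]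
  rw [h4] at h1
  refine (h1.trans (add_le_add (h2.trans (add_le_add b1 b2)) (h3.trans (add_le_add b3 b4)))).trans
    (le_of_eq ?_)
  push_cast
  ring

/-- Moving the evaluation point to its integer part is harmless. -/
lemma norm_cauchySum_sub_floor_le (s : Finset ℤ) (f : ℤ → ℂ) (x : ℝ) :
    ‖cauchySum s f ⌊x⌋ - cauchySum s f x‖ ≤ 2 * decaySum s f ⌊x⌋ := by
  rw [cauchySum, cauchySum, ← Finset.sum_sub_distrib, decaySum, Finset.mul_sum]
  refine norm_sum_le_of_le _ fun j _ => ?_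
  set w : ℂ := (⌊x⌋ : ℝ) - j + Complex.I with hw
  set z : ℂ := (x : ℂ) - j + Complex.I with hz
  have hw0 : w ≠ 0 := sub_add_I_ne_zero _ j
  have hz0 : z ≠ 0 := sub_add_I_ne_zero _ j
  have hzw : ‖z - w‖ ≤ 1 := by
    have : z - w = ((x - ⌊x⌋ : ℝ) : ℂ) := by rw [hz, hw]; push_cast; ring
    rw [this, Complex.norm_real, Real.norm_eq_abs, abs_le]
    constructor <;> linarith [Int.floor_le x, Int.lt_floor_add_one x]
  have hz1 : 1 ≤ ‖z‖ := one_le_norm_sub_add_I _ _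
  have hwz : ‖w‖ ≤ 2 * ‖z‖ := by
    have : w = z - (z - w) := by ring
    have h2 := norm_sub_le z (z - w)
    rw [← this] at h2
    linarith
  have hwpos : 0 < ‖w‖ := norm_pos_iff.2 hw0
  have hzpos : 0 < ‖z‖ := norm_pos_iff.2 hz0
  have hker : decayKernel (⌊x⌋ - j) = (‖w‖ ^ 2)⁻¹ := by
    rw [hw, norm_sub_add_I_sq, decayKernel]
    push_cast
    rfl
  have hdiff : w⁻¹ - z⁻¹ = (z - w) / (w * z) := by field_simp
  rw [← mul_sub, hdiff, norm_mul, norm_div, norm_mul, hker]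
  have : ‖z - w‖ / (‖w‖ * ‖z‖) ≤ 2 * (‖w‖ ^ 2)⁻¹ := by
    rw [← div_eq_mul_inv, div_le_div_iff₀ (by positivity) (by positivity)]
    nlinarith [mul_le_mul hzw hwz hwpos.le zero_le_one]
  calc ‖f j‖ * (‖z - w‖ / (‖w‖ * ‖z‖)) ≤ ‖f j‖ * (2 * (‖w‖ ^ 2)⁻¹) := by gcongr
    _ = _ := by ring

/-- The discrete M. Riesz theorem for `1 < p ≤ 2`. -/
lemma exists_eLpNorm_count_cauchySum_le_of_le_two {p : ℝ≥0∞} (hp : 1 < p) (hp2 : p ≤ 2) :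
    ∃ C : ℝ≥0, ∀ (s : Finset ℤ) (f : ℤ → ℂ),
      eLpNorm (fun n : ℤ => cauchySum s f n) p Measure.count ≤ C * eLpNorm f p Measure.count := by
  have hp' : p < ∞ := hp2.trans_lt (by simp)
  obtain ⟨A, hA⟩ := exists_eLpNorm_cauchySum_le_of_le_two hp hp2
  obtain ⟨B, hB⟩ := exists_eLpNorm_decaySum_le hp hp'
  refine ⟨A + 2 * B, fun s f => ?_⟩
  rw [← eLpNorm_comp_floor]
  have hm : AEStronglyMeasurable (fun x : ℝ => cauchySum s f ⌊x⌋ - cauchySum s f x) volume := by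
    refine AEStronglyMeasurable.sub ?_ (continuous_cauchySum s f).aestronglyMeasurable
    exact (measurable_of_countable fun n : ℤ => cauchySum s f n).comp Int.measurable_floor
      |>.aestronglyMeasurable
  have h2 : eLpNorm (fun x : ℝ => cauchySum s f ⌊x⌋ - cauchySum s f x) p ≤
      2 * eLpNorm (decaySum s f) p Measure.count := by
    have := eLpNorm_le_mul_eLpNorm_of_ae_le_mul (μ := volume)
      (f := fun x : ℝ => cauchySum s f ⌊x⌋ - cauchySum s f x)
      (g := fun x : ℝ => decaySum s f ⌊x⌋) (c := 2) (Filter.Eventually.of_forall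
      fun x => by
        rw [Real.norm_of_nonneg (decaySum_nonneg _ _ _)]
        exact norm_cauchySum_sub_floor_le s f x) p
    rwa [eLpNorm_comp_floor, ENNReal.ofReal_ofNat] at this
  have h1 := eLpNorm_add_le (continuous_cauchySum s f).aestronglyMeasurable hm hp.le
  have h3 : cauchySum s f + (fun x : ℝ => cauchySum s f ⌊x⌋ - cauchySum s f x) =
      fun x : ℝ => cauchySum s f ⌊x⌋ := by
    funext x; simp
  rw [h3] at h1
  refine (h1.trans (add_le_add (hA s f) (h2.trans (mul_le_mul_right (hB s f) 2)))).trans (le_of_eq ?_)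
  push_cast
  ring


/-- The kernel of `cauchySum` is skew-Hermitian. -/
lemma sum_mul_cauchySum (s t : Finset ℤ) (f g : ℤ → ℂ) :
    ∑ n ∈ t, g n * cauchySum s f n =
      -∑ j ∈ s, f j * (starRingEnd ℂ) (cauchySum t (fun n => (starRingEnd ℂ) (g n)) j) := by
  simp only [cauchySum, map_sum, Finset.mul_sum]
  rw [Finset.sum_comm, ← Finset.sum_neg_distrib]
  refine Finset.sum_congr rfl fun j _ => ?_
  rw [← Finset.sum_neg_distrib]
  refine Finset.sum_congr rfl fun n _ => ?_
  simp only [map_mul, map_inv₀, map_add, map_sub, Complex.conj_I, Complex.conj_conj,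
    Complex.ofReal_intCast, map_intCast]
  rw [show (n : ℂ) - j + Complex.I = -(j - n + -Complex.I) by ring, inv_neg]
  ring

lemma sum_enorm_rpow_le {E : Type*} [ENorm E] {p : ℝ≥0∞} (hp : 1 < p) (hp' : p < ∞) (s : Finset ℤ)
    (f : ℤ → E) :
    (∑ j ∈ s, ‖f j‖ₑ ^ p.toReal) ^ (1 / p.toReal) ≤ eLpNorm f p Measure.count := by
  have h := (eLpNorm_count_le_iff hp hp' f _).1 le_rfl
  rw [one_div, ENNReal.rpow_inv_le_iff (by linarith [one_lt_toReal hp hp'])]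
  exact (ENNReal.sum_le_tsum s).trans h

/-- Duality: the kernel is skew-Hermitian, so the estimate for the conjugate exponent `r < 2`
transfers. -/
lemma exists_eLpNorm_count_cauchySum_le_of_two_lt {p : ℝ≥0∞} (hp2 : 2 < p) (hp' : p < ∞) :
    ∃ C : ℝ≥0, ∀ (s : Finset ℤ) (f : ℤ → ℂ),
      eLpNorm (fun n : ℤ => cauchySum s f n) p Measure.count ≤ C * eLpNorm f p Measure.count := by
  have hp : 1 < p := ENNReal.one_lt_two.trans hp2
  set q := p.toReal with hqdef
  have hq : 2 < q := by
    simpa using (ENNReal.toReal_lt_toReal (by simp) hp'.ne).2 hp2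
  have hq0 : 0 < q := by linarith
  set r := q / (q - 1) with hr
  have hqr : q.HolderConjugate r := Real.HolderConjugate.conjExponent (by linarith)
  have hr1 : 1 < ENNReal.ofReal r := by
    rw [← ENNReal.ofReal_one]
    exact (ENNReal.ofReal_lt_ofReal_iff hqr.symm.pos).2 hqr.symm.lt
  have hr2 : ENNReal.ofReal r ≤ 2 := by
    rw [← ENNReal.ofReal_ofNat]
    refine ENNReal.ofReal_le_ofReal ?_
    rw [hr, div_le_iff₀ (by linarith)]
    linarith
  have hrtop : ENNReal.ofReal r < ∞ := ENNReal.ofReal_lt_top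
  have hrr : (ENNReal.ofReal r).toReal = r := ENNReal.toReal_ofReal hqr.symm.pos.le
  obtain ⟨C, hC⟩ := exists_eLpNorm_count_cauchySum_le_of_le_two hr1 hr2
  refine ⟨C, fun s f => ?_⟩
  rw [eLpNorm_count_le_iff hp hp', ENNReal.tsum_eq_iSup_sum]
  refine iSup_le fun t => ?_
  set D : ℤ → ℂ := fun n => cauchySum s f n with hD
  set Y : ℝ≥0∞ := ∑ n ∈ t, ‖D n‖ₑ ^ q with hY
  have hYtop : Y ≠ ∞ := ENNReal.sum_ne_top.2 fun n _ =>
    ENNReal.rpow_ne_top_of_nonneg hq0.le enorm_ne_top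
  -- The extremal function in Hölder's inequality, cut off to the finite set `t`: pairing it with
  -- `D` gives `Y`, and its `ℓ^r` norm is `Y^(1/r)`.
  set g : ℤ → ℂ := fun n => if n ∈ t then D n * (‖D n‖ ^ (q - 2) : ℝ) else 0 with hg
  have hgD : ∀ n ∈ t, (starRingEnd ℂ) (g n) * D n = ((‖D n‖ ^ q : ℝ) : ℂ) := by
    intro n hn
    simp only [hg, hn, if_true, map_mul, Complex.conj_ofReal]
    rw [mul_right_comm, mul_comm ((starRingEnd ℂ) (D n)), Complex.mul_conj, ← Complex.ofReal_mul,
      Complex.normSq_eq_norm_sq]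
    congr 1
    rw [← Real.rpow_two, ← Real.rpow_add_of_nonneg (norm_nonneg _) (by norm_num) (by linarith)]
    congr 1; ring
  have hgnorm : ∀ n ∈ t, ‖g n‖ₑ ^ r = ‖D n‖ₑ ^ q := by
    intro n hn
    simp only [hg, hn, if_true]
    rw [enorm_mul, ← ofReal_norm (E := ℂ) ((‖D n‖ ^ (q - 2) : ℝ) : ℂ), Complex.norm_real,
      Real.norm_of_nonneg (by positivity), ← ENNReal.ofReal_rpow_of_nonneg (norm_nonneg _)
      (by linarith), ofReal_norm]
    nth_rw 1 [← ENNReal.rpow_one ‖D n‖ₑ]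
    rw [← ENNReal.rpow_add_of_nonneg _ _ zero_le_one (by linarith), ← ENNReal.rpow_mul]
    congr 1
    rw [hr]
    have : q - 1 ≠ 0 := by linarith
    field_simp
    ring
  have hgN : eLpNorm g (ENNReal.ofReal r) Measure.count ≤ Y ^ (1 / r) := by
    rw [eLpNorm_count_le_iff hr1 hrtop, hrr, ← ENNReal.rpow_mul, one_div_mul_cancel hqr.symm.ne_zero,
      ENNReal.rpow_one, hY, tsum_eq_sum (s := t)]
    · exact (Finset.sum_congr rfl hgnorm).le
    · intro n hn
      simp [hg, hn, hqr.symm.pos]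
  have hYle : Y ≤ eLpNorm f p Measure.count * (C * Y ^ (1 / r)) := by
    calc Y = ‖∑ n ∈ t, (starRingEnd ℂ) (g n) * D n‖ₑ := by
          rw [Finset.sum_congr rfl hgD, ← Complex.ofReal_sum, ← ofReal_norm, Complex.norm_real,
            Real.norm_of_nonneg (Finset.sum_nonneg fun _ _ => by positivity),
            ENNReal.ofReal_sum_of_nonneg fun _ _ => by positivity]
          refine Finset.sum_congr rfl fun n _ => ?_
          rw [← ENNReal.ofReal_rpow_of_nonneg (norm_nonneg _) hq0.le, ofReal_norm]
      _ ≤ ∑ j ∈ s, ‖f j‖ₑ * ‖cauchySum t g j‖ₑ := by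
          rw [hD, sum_mul_cauchySum, enorm_neg]
          refine (enorm_sum_le _ _).trans (le_of_eq (Finset.sum_congr rfl fun j _ => ?_))
          simp only [Complex.conj_conj]
          rw [enorm_mul]
          simp [enorm_eq_nnnorm]
      _ ≤ (∑ j ∈ s, ‖f j‖ₑ ^ q) ^ (1 / q) * (∑ j ∈ s, ‖cauchySum t g j‖ₑ ^ r) ^ (1 / r) :=
          ENNReal.inner_le_Lp_mul_Lq _ _ _ hqr
      _ ≤ eLpNorm f p Measure.count * (C * Y ^ (1 / r)) := by
          gcongr
          · exact sum_enorm_rpow_le hp hp' s f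
          · have := sum_enorm_rpow_le hr1 hrtop s fun j : ℤ => cauchySum t g j
            rw [hrr] at this
            exact this.trans ((hC t g).trans (by gcongr))
  -- Dividing by `Y^(1/r)` needs `Y ≠ 0`, and `Y ≠ ∞`, which holds because `t` is finite.
  rcases eq_or_ne Y 0 with h0 | h0
  · rw [h0]; exact zero_le
  have hYr0 : Y ^ (1 / r) ≠ 0 := by simp [h0, hYtop]
  have hYrt : Y ^ (1 / r) ≠ ∞ := ENNReal.rpow_ne_top_of_nonneg (by have := hqr.symm.pos; positivity) hYtop
  have hsplit : Y = Y ^ (1 / q) * Y ^ (1 / r) := by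
    rw [← ENNReal.rpow_add _ _ h0 hYtop, one_div, one_div, hqr.inv_add_inv_eq_one, ENNReal.rpow_one]
  have : Y ^ (1 / q) ≤ C * eLpNorm f p Measure.count := by
    refine (ENNReal.mul_le_mul_iff_left hYr0 hYrt).1 ?_
    rw [← hsplit]
    exact hYle.trans (le_of_eq (by ring))
  rwa [one_div, ENNReal.rpow_inv_le_iff hq0] at this

/-- The discrete M. Riesz theorem. -/
theorem exists_eLpNorm_count_cauchySum_le {p : ℝ≥0∞} (hp : 1 < p) (hp' : p < ∞) :
    ∃ C : ℝ≥0, ∀ (s : Finset ℤ) (f : ℤ → ℂ),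
      eLpNorm (fun n : ℤ => cauchySum s f n) p Measure.count ≤ C * eLpNorm f p Measure.count := by
  rcases le_or_gt p 2 with h | h
  · exact exists_eLpNorm_count_cauchySum_le_of_le_two hp h
  · exact exists_eLpNorm_count_cauchySum_le_of_two_lt h hp'

/-! ### Integration by parts for functions of bounded variation. -/

/-- Integration by parts against the primitive of `Q`, corrected so as to vanish at both ends. The
function `H` need not extend continuously to the ends. -/
lemma integral_mul_eq_of_bounded {a b M : ℝ} (hab : a < b) {H : ℝ → ℝ} {Q : ℝ → ℂ}
    (hQ : Continuous Q) (hd : ∀ t ∈ Set.Ioo a b, DifferentiableAt ℝ H t)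
    (hM : ∀ t ∈ Set.Ioo a b, |H t| ≤ M) (hH : IntervalIntegrable H volume a b)
    (hH' : IntervalIntegrable (deriv H) volume a b) :
    ∫ t in a..b, (H t : ℂ) * Q t =
      ∫ t in a..b, ((H t : ℂ) * ((∫ u in a..b, Q u) / (b - a)) -
        ((deriv H t : ℝ) : ℂ) * ((∫ u in a..t, Q u) - (t - a) * ((∫ u in a..b, Q u) / (b - a)))) := by
  have hba : (b : ℂ) - a ≠ 0 := by
    rw [← Complex.ofReal_sub]; exact_mod_cast (sub_pos.2 hab).ne'
  set c : ℂ := (∫ u in a..b, Q u) / (b - a) with hc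
  set E : ℝ → ℂ := fun t => (∫ u in a..t, Q u) - (t - a) * c with hE
  have hEd : ∀ t, HasDerivAt E (Q t - c) t := by
    intro t
    have h1 : HasDerivAt (fun t : ℝ => ∫ u in a..t, Q u) (Q t) t := hQ.integral_hasStrictDerivAt a t
      |>.hasDerivAt
    have h2 : HasDerivAt (fun t : ℝ => ((t : ℂ) - a) * c) c t := by
      simpa using ((Complex.ofRealCLM.hasDerivAt (x := t)).sub_const (a : ℂ)).mul_const c
    exact h1.sub h2
  have hEc : Continuous E := continuous_iff_continuousAt.2 fun t => (hEd t).continuousAt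
  have hEa : E a = 0 := by simp [hE]
  have hEb : E b = 0 := by simp only [hE, hc]; field_simp; ring
  have hHc : IntervalIntegrable (fun t => (H t : ℂ)) volume a b :=
    ⟨hH.1.ofReal, hH.2.ofReal⟩
  have hHc' : IntervalIntegrable (fun t => ((deriv H t : ℝ) : ℂ)) volume a b :=
    ⟨hH'.1.ofReal, hH'.2.ofReal⟩
  have i1 : IntervalIntegrable (fun t => (H t : ℂ) * Q t) volume a b :=
    hHc.mul_continuousOn hQ.continuousOn
  have i2 : IntervalIntegrable (fun t => (H t : ℂ) * c) volume a b :=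
    hHc.mul_continuousOn continuousOn_const
  have i3 : IntervalIntegrable (fun t => ((deriv H t : ℝ) : ℂ) * E t) volume a b :=
    hHc'.mul_continuousOn hEc.continuousOn
  have hlim : ∀ {l : Filter ℝ} {t : ℝ}, l ≤ nhds t → Set.Ioo a b ∈ l → E t = 0 →
      Filter.Tendsto (fun t => (H t : ℂ) * E t) l (nhds 0) := by
    intro l t hl hl' ht
    have h0 : Filter.Tendsto E l (nhds 0) := ht ▸ (hEc.tendsto t).mono_left hl
    refine squeeze_zero_norm' (a := fun t => M * ‖E t‖) ?_ (by simpa using h0.norm.const_mul M)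
    filter_upwards [hl'] with t ht
    rw [norm_mul, Complex.norm_real]
    exact mul_le_mul_of_nonneg_right (hM t ht) (norm_nonneg _)
  have hftc := intervalIntegral.integral_eq_sub_of_hasDerivAt_of_tendsto hab
    (f := fun t => (H t : ℂ) * E t) (f' := fun t => ((deriv H t : ℝ) : ℂ) * E t + (H t : ℂ) * (Q t - c))
    (fun t ht => (hd t ht).hasDerivAt.ofReal_comp.mul (hEd t))
    (i3.add (by simpa only [mul_sub] using i1.sub i2))
    (hlim nhdsWithin_le_nhds (Ioo_mem_nhdsGT hab) hEa)
    (hlim nhdsWithin_le_nhds (Ioo_mem_nhdsLT hab) hEb)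
  rw [intervalIntegral.integral_sub i2 i3]
  simp only [mul_sub] at hftc
  rw [intervalIntegral.integral_add i3 (i1.sub i2), intervalIntegral.integral_sub i1 i2] at hftc
  linear_combination hftc

/-- Since `b - a ≥ 1`, the mean of `Q` is no larger than its full integral; nor is the linear
correction, because `t - a ≤ b - a`. -/
lemma enorm_integral_mul_le_of_bounded {a b M : ℝ} (hab : 1 ≤ b - a) {H : ℝ → ℝ} {Q : ℝ → ℂ}
    (hQ : Continuous Q) (hd : ∀ t ∈ Set.Ioo a b, DifferentiableAt ℝ H t)
    (hM : ∀ t ∈ Set.Ioo a b, |H t| ≤ M) (hH : Integrable H) (hH' : Integrable (deriv H)) {Z : ℝ → ℝ≥0∞}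
    (hZ : ∀ t ∈ Set.Ioc a b, ‖∫ u in a..t, Q u‖ₑ + ‖∫ u in a..b, Q u‖ₑ ≤ Z t) :
    ‖∫ t in Set.Ioc a b, (H t : ℂ) * Q t‖ₑ ≤
      ∫⁻ t in Set.Ioc a b, (‖H t‖ₑ + ‖deriv H t‖ₑ) * Z t := by
  have hlt : a < b := by linarith
  have hba : ‖((b : ℂ) - a)‖ = b - a := by
    rw [← Complex.ofReal_sub, Complex.norm_real, Real.norm_of_nonneg (by linarith)]
  rw [← intervalIntegral.integral_of_le hlt.le,
    integral_mul_eq_of_bounded hlt hQ hd hM hH.intervalIntegrable hH'.intervalIntegrable,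
    intervalIntegral.integral_of_le hlt.le]
  refine (enorm_integral_le_lintegral_enorm _).trans (setLIntegral_mono' measurableSet_Ioc ?_)
  intro t ht
  set B := ∫ u in a..b, Q u
  set E := ∫ u in a..t, Q u
  have h1 : ‖B / (b - a)‖ₑ ≤ ‖B‖ₑ := by
    rw [enorm_le_iff_norm_le, norm_div, hba]
    exact div_le_self (norm_nonneg _) hab
  have h2 : ‖((t : ℂ) - a) * (B / (b - a))‖ₑ ≤ ‖B‖ₑ := by
    rw [enorm_le_iff_norm_le, norm_mul, norm_div, hba, ← Complex.ofReal_sub, Complex.norm_real,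
      Real.norm_of_nonneg (by linarith [ht.1]), mul_div_assoc', div_le_iff₀ (by linarith), mul_comm]
    exact mul_le_mul_of_nonneg_left (by linarith [ht.2]) (norm_nonneg _)
  have e : ∀ r : ℝ, ‖(r : ℂ)‖ₑ = ‖r‖ₑ := fun r => by simp [enorm_eq_nnnorm]
  calc ‖(H t : ℂ) * (B / (b - a)) - ((deriv H t : ℝ) : ℂ) * (E - (t - a) * (B / (b - a)))‖ₑ
      ≤ ‖H t‖ₑ * ‖B‖ₑ + ‖deriv H t‖ₑ * (‖E‖ₑ + ‖B‖ₑ) := by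
        refine (enorm_sub_le).trans ?_
        rw [enorm_mul, enorm_mul, e, e]
        gcongr
        exact (enorm_sub_le).trans (by gcongr)
    _ ≤ ‖H t‖ₑ * Z t + ‖deriv H t‖ₑ * Z t := by
        gcongr
        · exact le_add_self.trans (hZ t ht)
        · exact hZ t ht
    _ = _ := by ring

/-- A function that is integrable and of bounded variation on `ℝ`, with jumps, if any, in `2πℤ`. -/
structure PiecewiseBV (H : ℝ → ℝ) : Prop where
  integrable : Integrable H
  integrable_deriv : Integrable (deriv H)
  bounded : ∃ M, ∀ t : ℝ, (∀ k : ℤ, t ≠ 2 * Real.pi * k) → |H t| ≤ M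
  differentiableAt : ∀ t : ℝ, (∀ k : ℤ, t ≠ 2 * Real.pi * k) → DifferentiableAt ℝ H t

lemma iUnion_Ioc_two_pi :
    ⋃ k : ℤ, Set.Ioc (2 * Real.pi * k) (2 * Real.pi * (k + 1)) = Set.univ := by
  have h := iUnion_Ioc_add_zsmul Real.two_pi_pos 0
  rw [← h]
  refine Set.iUnion_congr fun k => ?_
  congr 1 <;> simp <;> ring

lemma pairwise_disjoint_Ioc_two_pi : Pairwise (Function.onFun Disjoint fun k : ℤ =>
    Set.Ioc (2 * Real.pi * k) (2 * Real.pi * (k + 1))) := by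
  have h := Set.pairwise_disjoint_Ioc_add_zsmul (0 : ℝ) (2 * Real.pi)
  intro i j hij
  have := h hij
  simp only [Function.onFun] at this ⊢
  convert! this using 2 <;> simp <;> ring

/-- The line is cut at 2πℤ: each open cell is free of jumps and has length `2π ≥ 1`. -/
lemma PiecewiseBV.enorm_integral_mul_le {H : ℝ → ℝ} (hH : PiecewiseBV H) {Q : ℝ → ℂ}
    (hQ : Continuous Q) {c : ℝ} (hQc : ∀ t, ‖Q t‖ ≤ c) {Z : ℝ → ℝ≥0∞}
    (hZ : ∀ k : ℤ, ∀ t ∈ Set.Ioc (2 * Real.pi * k) (2 * Real.pi * (k + 1)),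
      ‖∫ u in (2 * Real.pi * k)..t, Q u‖ₑ +
        ‖∫ u in (2 * Real.pi * k)..(2 * Real.pi * (k + 1)), Q u‖ₑ ≤ Z t) :
    ‖∫ t, (H t : ℂ) * Q t‖ₑ ≤ ∫⁻ t, (‖H t‖ₑ + ‖deriv H t‖ₑ) * Z t := by
  obtain ⟨M, hM⟩ := hH.bounded
  have hint : Integrable fun t => (H t : ℂ) * Q t :=
    hH.integrable.ofReal.mul_bdd hQ.aestronglyMeasurable (Filter.Eventually.of_forall hQc)
  rw [← setIntegral_univ, ← iUnion_Ioc_two_pi,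
    integral_iUnion (fun _ => measurableSet_Ioc) pairwise_disjoint_Ioc_two_pi hint.integrableOn]
  refine (enorm_tsum_le_tsum_enorm).trans ?_
  rw [← setLIntegral_univ, ← iUnion_Ioc_two_pi,
    lintegral_iUnion (fun _ => measurableSet_Ioc) pairwise_disjoint_Ioc_two_pi]
  refine ENNReal.tsum_le_tsum fun k => ?_
  have hne : ∀ t ∈ Set.Ioo (2 * Real.pi * k) (2 * Real.pi * (k + 1)), ∀ m : ℤ,
      t ≠ 2 * Real.pi * m := by
    rintro t ht m rfl
    have h1 := lt_of_mul_lt_mul_left ht.1 Real.two_pi_pos.le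
    have h2 := lt_of_mul_lt_mul_left ht.2 Real.two_pi_pos.le
    norm_cast at h1 h2
    omega
  refine enorm_integral_mul_le_of_bounded ?_ hQ (fun t ht => hH.differentiableAt t (hne t ht))
    (fun t ht => hM t (hne t ht)) hH.integrable hH.integrable_deriv (hZ k)
  nlinarith [Real.pi_gt_three]

/-! ### Character integrals and the multiplier theorem. -/

/-- The integral of the character `exp (i y u)` from `a` to `t`. -/
noncomputable def charIntegral (y a t : ℝ) : ℂ := ∫ u in a..t, Complex.exp (Complex.I * y * u)

lemma norm_exp_I_mul (y t : ℝ) : ‖Complex.exp (Complex.I * y * t)‖ = 1 := by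
  rw [show Complex.I * y * t = ((y * t : ℝ) : ℂ) * Complex.I by push_cast; ring,
    Complex.norm_exp_ofReal_mul_I]

lemma I_mul_charIntegral (y a t : ℝ) : Complex.I * y * charIntegral y a t =
    Complex.exp (Complex.I * y * t) - Complex.exp (Complex.I * y * a) := by
  rcases eq_or_ne y 0 with rfl | hy
  · simp
  have hc : Complex.I * (y : ℂ) ≠ 0 := mul_ne_zero Complex.I_ne_zero (by exact_mod_cast hy)
  rw [charIntegral, integral_exp_mul_complex hc, mul_div_cancel₀ _ hc]

/-- Trades the singular factor `1/(iy)` for a multiple of `(y + i)⁻¹`. The remainder gains another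
such factor and so is of summable size `‖y + i‖⁻²`. -/
lemma charIntegral_eq (y a t : ℝ) (hy : (y : ℂ) + Complex.I ≠ 0) : charIntegral y a t =
    -Complex.I * (Complex.exp (Complex.I * y * t) - Complex.exp (Complex.I * y * a)) *
      ((y : ℂ) + Complex.I)⁻¹ + Complex.I * charIntegral y a t * ((y : ℂ) + Complex.I)⁻¹ := by
  rw [← I_mul_charIntegral]
  field_simp
  linear_combination (charIntegral y a t * y) * Complex.I_sq

/-- Oscillation gives `|y| ‖K‖ ≤ 2`, the length of the interval gives `‖K‖ ≤ 2π`, and `2 + 2π < 10`.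
-/
lemma norm_add_I_mul_charIntegral_le {y a t : ℝ} (hat : a ≤ t) (hta : t ≤ a + 2 * Real.pi) :
    ‖(y : ℂ) + Complex.I‖ * ‖charIntegral y a t‖ ≤ 10 := by
  have h1 : ‖charIntegral y a t‖ ≤ 2 * Real.pi := by
    have := intervalIntegral.norm_integral_le_of_norm_le_const (a := a) (b := t) (C := 1)
      (f := fun u : ℝ => Complex.exp (Complex.I * y * u)) fun u _ => (norm_exp_I_mul y u).le
    rw [abs_of_nonneg (by linarith)] at this
    exact this.trans (by linarith)
  have h2 : ‖Complex.I * y * charIntegral y a t‖ ≤ 2 := by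
    rw [I_mul_charIntegral]
    refine (norm_sub_le _ _).trans ?_
    rw [norm_exp_I_mul, norm_exp_I_mul]
    norm_num
  rw [norm_mul, norm_mul, Complex.norm_I, one_mul] at h2
  have h3 : ‖(y : ℂ) + Complex.I‖ ≤ ‖(y : ℂ)‖ + 1 := by
    simpa using norm_add_le (y : ℂ) Complex.I
  have := Real.pi_lt_d2
  nlinarith [norm_nonneg (charIntegral y a t)]

/-- Modulation of a sequence. -/
noncomputable def modulate (t : ℝ) (f : ℤ → ℂ) (j : ℤ) : ℂ :=
  f j * Complex.exp (-(Complex.I * j * t))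

/-- Makes the terms at the cell endpoints independent of the cell. -/
lemma modulate_two_pi_mul (k : ℤ) (f : ℤ → ℂ) : modulate (2 * Real.pi * k) f = f := by
  funext j
  have : -(Complex.I * j * ((2 * Real.pi * k : ℝ) : ℂ)) = ((-(j * k) : ℤ) : ℂ) * (2 * Real.pi * Complex.I) := by
    push_cast; ring
  rw [modulate, this, Complex.exp_int_mul_two_pi_mul_I, mul_one]

lemma norm_modulate (t : ℝ) (f : ℤ → ℂ) (j : ℤ) : ‖modulate t f j‖ = ‖f j‖ := by
  rw [modulate, norm_mul]
  have : -(Complex.I * j * (t : ℂ)) = ((-(j * t) : ℝ) : ℂ) * Complex.I := by push_cast; ring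
  rw [this, Complex.norm_exp_ofReal_mul_I, mul_one]

lemma eLpNorm_modulate (t : ℝ) (f : ℤ → ℂ) (p : ℝ≥0∞) :
    eLpNorm (modulate t f) p Measure.count = eLpNorm f p Measure.count :=
  eLpNorm_congr_norm_ae (Filter.Eventually.of_forall (norm_modulate t f))

lemma norm_cauchySum_le_floor (s : Finset ℤ) (f : ℤ → ℂ) (x : ℝ) :
    ‖cauchySum s f x‖ ≤ ‖cauchySum s f ⌊x⌋‖ + 2 * decaySum s f ⌊x⌋ := by
  have h1 := norm_cauchySum_sub_floor_le s f x
  have h2 := norm_sub_norm_le (cauchySum s f x) (cauchySum s f ⌊x⌋)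
  rw [norm_sub_rev] at h2
  linarith

/-- The exponential splits as `exp(ixt) exp(-ijt)`, so each endpoint contributes a unimodular factor
times the Riesz sum of a modulated sequence. Moving these two sums to `⌊x⌋` costs 2 each and the
remainder 30, which makes 34. -/
lemma norm_sum_charIntegral_le (s : Finset ℤ) (f : ℤ → ℂ) (x : ℝ) {a t : ℝ} (hat : a ≤ t)
    (hta : t ≤ a + 2 * Real.pi) :
    ‖∑ j ∈ s, f j * charIntegral (x - j) a t‖ ≤
      ‖cauchySum s (modulate t f) ⌊x⌋‖ + ‖cauchySum s (modulate a f) ⌊x⌋‖ +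
        34 * decaySum s f ⌊x⌋ := by
  have hdm : ∀ u, decaySum s (modulate u f) = decaySum s f := fun u => by
    funext n; simp only [decaySum, norm_modulate]
  set R : ℂ := ∑ j ∈ s, f j * (Complex.I * charIntegral (x - j) a t * ((x : ℂ) - j + Complex.I)⁻¹)
    with hR
  have hsum : ∑ j ∈ s, f j * charIntegral (x - j) a t =
      -Complex.I * Complex.exp (Complex.I * x * t) * cauchySum s (modulate t f) x +
      Complex.I * Complex.exp (Complex.I * x * a) * cauchySum s (modulate a f) x + R := by
    rw [hR, cauchySum, cauchySum, Finset.mul_sum, Finset.mul_sum, ← Finset.sum_add_distrib,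
      ← Finset.sum_add_distrib]
    refine Finset.sum_congr rfl fun j _ => ?_
    have hne : ((x - j : ℝ) : ℂ) + Complex.I ≠ 0 := by
      have := sub_add_I_ne_zero x j
      push_cast
      exact this
    have hexp : ∀ u : ℝ, Complex.exp (Complex.I * (x - j : ℝ) * u) =
        Complex.exp (Complex.I * x * u) * Complex.exp (-(Complex.I * j * u)) := fun u => by
      rw [← Complex.exp_add]; congr 1; push_cast; ring
    nth_rw 1 [charIntegral_eq _ _ _ hne]
    rw [hexp, hexp, modulate, modulate]
    push_cast
    ring
  have hRle : ‖R‖ ≤ 30 * decaySum s f ⌊x⌋ := by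
    rw [hR, decaySum, Finset.mul_sum]
    refine norm_sum_le_of_le _ fun j _ => ?_
    have h1 := norm_add_I_mul_charIntegral_le (y := x - j) hat hta
    have h2 := inv_one_add_sq_le x j
    rw [← norm_sub_add_I_sq] at h2
    have h3 : 0 < ‖(x : ℂ) - j + Complex.I‖ := by linarith [one_le_norm_sub_add_I x j]
    push_cast at h1
    rw [norm_mul, norm_mul, norm_mul, Complex.norm_I, one_mul, norm_inv]
    set w := ‖(x : ℂ) - j + Complex.I‖
    calc ‖f j‖ * (‖charIntegral (x - j) a t‖ * w⁻¹)
        = ‖f j‖ * (w * ‖charIntegral (x - j) a t‖ * (w ^ 2)⁻¹) := by field_simp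
      _ ≤ ‖f j‖ * (10 * (3 * decayKernel (⌊x⌋ - j))) := by gcongr
      _ = _ := by ring
  have h1 := norm_cauchySum_le_floor s (modulate t f) x
  have h2 := norm_cauchySum_le_floor s (modulate a f) x
  rw [hdm] at h1 h2
  rw [hsum]
  refine (norm_add_le_of_le (norm_add_le _ _) hRle).trans ?_
  rw [norm_mul, norm_mul, norm_mul, norm_mul, norm_neg, Complex.norm_I, norm_exp_I_mul,
    norm_exp_I_mul]
  linarith

/-- A bound for the partial integrals of `∑ j ∈ s, f j * exp (i (x - j) u)` that depends on `x` only
through its integer part. -/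
noncomputable def integralBound (s : Finset ℤ) (f : ℤ → ℂ) (t : ℝ) (n : ℤ) : ℝ :=
  ‖cauchySum s (modulate t f) n‖ + 3 * ‖cauchySum s f n‖ + 68 * decaySum s f n

lemma integralBound_nonneg (s : Finset ℤ) (f : ℤ → ℂ) (t : ℝ) (n : ℤ) :
    0 ≤ integralBound s f t n := by
  have := decaySum_nonneg s f n
  unfold integralBound
  positivity

lemma continuous_integralBound (s : Finset ℤ) (f : ℤ → ℂ) (n : ℤ) :
    Continuous fun t => integralBound s f t n := by
  unfold integralBound cauchySum modulate
  fun_prop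

lemma exists_eLpNorm_integralBound_le {p : ℝ≥0∞} (hp : 1 < p) (hp' : p < ∞) :
    ∃ C : ℝ≥0, ∀ (s : Finset ℤ) (f : ℤ → ℂ) (t : ℝ),
      eLpNorm (integralBound s f t) p Measure.count ≤ C * eLpNorm f p Measure.count := by
  obtain ⟨A, hA⟩ := exists_eLpNorm_count_cauchySum_le hp hp'
  obtain ⟨B, hB⟩ := exists_eLpNorm_decaySum_le hp hp'
  refine ⟨A + 3 * A + 68 * B, fun s f t => ?_⟩
  have m : ∀ g : ℤ → ℝ, AEStronglyMeasurable g Measure.count := fun g =>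
    StronglyMeasurable.of_discrete.aestronglyMeasurable
  set g₁ : ℤ → ℝ := fun n => ‖cauchySum s (modulate t f) n‖
  set g₂ : ℤ → ℝ := fun n => ‖cauchySum s f n‖
  have e : integralBound s f t = (g₁ + (3 : ℝ) • g₂) + (68 : ℝ) • decaySum s f := by
    funext n; simp [integralBound, g₁, g₂]
  have h1 : eLpNorm g₁ p Measure.count ≤ A * eLpNorm f p Measure.count := by
    rw [← eLpNorm_modulate t f, eLpNorm_norm (fun n : ℤ => cauchySum s (modulate t f) n)]
    exact hA s _
  have h2 : eLpNorm ((3 : ℝ) • g₂) p Measure.count ≤ 3 * (A * eLpNorm f p Measure.count) := by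
    rw [eLpNorm_const_smul, eLpNorm_norm (fun n : ℤ => cauchySum s f n)]
    have : ‖(3 : ℝ)‖ₑ = 3 := by rw [← ofReal_norm]; norm_num
    rw [this]
    exact mul_le_mul_right (hA s f) 3
  have h3 : eLpNorm ((68 : ℝ) • decaySum s f) p Measure.count ≤
      68 * (B * eLpNorm f p Measure.count) := by
    rw [eLpNorm_const_smul]
    have : ‖(68 : ℝ)‖ₑ = 68 := by rw [← ofReal_norm]; norm_num
    rw [this]
    exact mul_le_mul_right (hB s f) 68
  rw [e]
  refine (eLpNorm_add_le (m _) (m _) hp.le).trans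
    ((add_le_add ((eLpNorm_add_le (m _) (m _) hp.le).trans (add_le_add h1 h2)) h3).trans
      (le_of_eq ?_))
  push_cast
  ring

lemma enorm_inv_sqrt_two_pi_le : ‖((Real.sqrt (2 * Real.pi))⁻¹ : ℂ)‖ₑ ≤ 1 := by
  rw [← Complex.ofReal_inv, ← ofReal_norm, Complex.norm_real, Real.norm_of_nonneg (by positivity),
    ← ENNReal.ofReal_one]
  refine ENNReal.ofReal_le_ofReal (inv_le_one_of_one_le₀ ?_)
  rw [Real.one_le_sqrt]
  nlinarith [Real.pi_gt_three]

lemma PiecewiseBV.enorm_sum_fourierInv_le {H : ℝ → ℝ} (hH : PiecewiseBV H) (s : Finset ℤ)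
    (f : ℤ → ℂ) (x : ℝ) :
    ‖∑ j ∈ s, f j * fourierInv (fun ξ => (H ξ : ℂ)) (x - j)‖ₑ ≤
      ∫⁻ t, (‖H t‖ₑ + ‖deriv H t‖ₑ) * ENNReal.ofReal (integralBound s f t ⌊x⌋) := by
  set Q : ℝ → ℂ := fun u => ∑ j ∈ s, f j * Complex.exp (Complex.I * (x - j : ℝ) * u) with hQdef
  have hQ : Continuous Q := by fun_prop
  have hQE : ∀ a t : ℝ, ∫ u in a..t, Q u = ∑ j ∈ s, f j * charIntegral (x - j) a t := by
    intro a t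
    rw [hQdef, intervalIntegral.integral_finsetSum]
    · refine Finset.sum_congr rfl fun j _ => ?_
      rw [intervalIntegral.integral_const_mul, charIntegral]
    · intro j _
      exact Continuous.intervalIntegrable (by fun_prop) _ _
  have hint : ∑ j ∈ s, f j * fourierInv (fun ξ => (H ξ : ℂ)) (x - j) =
      ((Real.sqrt (2 * Real.pi))⁻¹ : ℂ) * ∫ t, (H t : ℂ) * Q t := by
    have : ∀ t, (H t : ℂ) * Q t =
        ∑ j ∈ s, f j * ((H t : ℂ) * Complex.exp (Complex.I * (x - j : ℝ) * t)) := by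
      intro t
      rw [hQdef, Finset.mul_sum]
      exact Finset.sum_congr rfl fun j _ => by ring
    simp only [this]
    rw [integral_finsetSum, Finset.mul_sum]
    · refine Finset.sum_congr rfl fun j _ => ?_
      rw [integral_const_mul, fourierInv]
      ring
    · intro j _
      refine Integrable.const_mul ?_ _
      exact hH.integrable.ofReal.mul_bdd (c := 1) (by fun_prop)
        (Filter.Eventually.of_forall fun t => (norm_exp_I_mul _ _).le)
  rw [hint, enorm_mul]
  refine (mul_le_of_le_one_left' enorm_inv_sqrt_two_pi_le).trans ?_
  refine hH.enorm_integral_mul_le hQ (c := ∑ j ∈ s, ‖f j‖) (fun t => ?_) fun k t ht => ?_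
  · refine norm_sum_le_of_le _ fun j _ => ?_
    rw [norm_mul, norm_exp_I_mul, mul_one]
  · have hk : (2 * Real.pi * (k + 1) : ℝ) = 2 * Real.pi * ((k + 1 : ℤ) : ℝ) := by push_cast; rfl
    have hk2 : (2 * Real.pi * (k + 1) : ℝ) = 2 * Real.pi * k + 2 * Real.pi := by ring
    have h1 := norm_sum_charIntegral_le s f x ht.1.le (by linarith [ht.2])
    have h2 := norm_sum_charIntegral_le s f x (a := 2 * Real.pi * k) (t := 2 * Real.pi * (k + 1))
      (by linarith [Real.pi_pos]) (by linarith)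
    rw [modulate_two_pi_mul] at h1
    rw [modulate_two_pi_mul, hk, modulate_two_pi_mul] at h2
    rw [hQE, hQE, ← ofReal_norm, ← ofReal_norm, ← ENNReal.ofReal_add (norm_nonneg _) (norm_nonneg _)]
    -- Of the four Riesz sums in `h1` and `h2`, three sit at multiples of 2π and are unmodulated;
    -- this is the 3 in `integralBound`, and 68 is `2 * 34`.
    refine ENNReal.ofReal_le_ofReal ?_
    rw [integralBound, hk]
    linarith

/-- The same integration by parts for a single character. This decay lies in every `ℓ^r` with `r >
1` over integer shifts, which gives absolute convergence of the interpolation series. -/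
lemma PiecewiseBV.norm_fourierInv_le {H : ℝ → ℝ} (hH : PiecewiseBV H) :
    ∃ C : ℝ, ∀ y : ℝ, ‖fourierInv (fun ξ => (H ξ : ℂ)) y‖ ≤ C / ‖(y : ℂ) + Complex.I‖ := by
  set V : ℝ≥0∞ := ∫⁻ t, (‖H t‖ₑ + ‖deriv H t‖ₑ) with hV
  have hVtop : V ≠ ∞ := by
    rw [hV, lintegral_add_left' hH.integrable.aestronglyMeasurable.enorm]
    exact ENNReal.add_ne_top.2 ⟨hH.integrable.2.ne, hH.integrable_deriv.2.ne⟩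
  refine ⟨V.toReal * 20, fun y => ?_⟩
  have hy : 0 < ‖(y : ℂ) + Complex.I‖ := by
    have := one_le_norm_sub_add_I y 0
    simp only [Int.cast_zero, sub_zero] at this
    linarith
  have hK : ∀ {a t : ℝ}, a ≤ t → t ≤ a + 2 * Real.pi →
      ‖charIntegral y a t‖ₑ ≤ ENNReal.ofReal (10 / ‖(y : ℂ) + Complex.I‖) := by
    intro a t h1 h2
    rw [← ofReal_norm]
    refine ENNReal.ofReal_le_ofReal ?_
    rw [le_div_iff₀ hy, mul_comm]
    exact norm_add_I_mul_charIntegral_le h1 h2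
  have h := hH.enorm_integral_mul_le (Q := fun u : ℝ => Complex.exp (Complex.I * y * u))
    (by fun_prop) (fun t => (norm_exp_I_mul y t).le)
    (Z := fun _ => ENNReal.ofReal (20 / ‖(y : ℂ) + Complex.I‖)) (fun k t ht => by
      refine (add_le_add (hK ht.1.le (by linarith [ht.2])) (hK (a := 2 * Real.pi * k)
        (t := 2 * Real.pi * (k + 1)) (by linarith [Real.pi_pos]) (by linarith))).trans (le_of_eq ?_)
      rw [← ENNReal.ofReal_add (by positivity) (by positivity)]
      congr 1; ring)
  have h1 : ‖fourierInv (fun ξ => (H ξ : ℂ)) y‖ₑ ≤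
      V * ENNReal.ofReal (20 / ‖(y : ℂ) + Complex.I‖) := by
    rw [fourierInv, enorm_mul]
    refine (mul_le_of_le_one_left' enorm_inv_sqrt_two_pi_le).trans (h.trans (le_of_eq ?_))
    rw [lintegral_mul_const' _ _ ENNReal.ofReal_ne_top]
  have h2 := ENNReal.toReal_mono (ENNReal.mul_ne_top hVtop ENNReal.ofReal_ne_top) h1
  rw [toReal_enorm, ENNReal.toReal_mul, ENNReal.toReal_ofReal (by positivity)] at h2
  exact h2.trans (le_of_eq (by ring))

lemma continuous_fourierInv {H : ℝ → ℝ} (hH : Integrable H) :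
    Continuous (fourierInv fun ξ => (H ξ : ℂ)) := by
  unfold fourierInv
  refine continuous_const.mul (continuous_of_dominated (bound := fun ξ => ‖H ξ‖) (fun y => ?_)
    (fun y => Filter.Eventually.of_forall fun ξ => ?_) hH.norm
    (Filter.Eventually.of_forall fun ξ => by fun_prop))
  · exact hH.ofReal.aestronglyMeasurable.mul (by fun_prop)
  · rw [norm_mul, norm_exp_I_mul, mul_one, Complex.norm_real]

/-- Interpolation operators with piecewise absolutely continuous Fourier transform of bounded
variation are bounded from `ℓ^p` to `L^p`. -/
theorem exists_eLpNorm_sum_fourierInv_le {p : ℝ≥0∞} (hp : 1 < p) (hp' : p < ∞) :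
    ∃ C : ℝ≥0, ∀ H : ℝ → ℝ, PiecewiseBV H → ∀ (s : Finset ℤ) (f : ℤ → ℂ),
      eLpNorm (fun x : ℝ => ∑ j ∈ s, f j * fourierInv (fun ξ => (H ξ : ℂ)) (x - j)) p ≤
        C * (∫⁻ t, (‖H t‖ₑ + ‖deriv H t‖ₑ)) * eLpNorm f p Measure.count := by
  obtain ⟨C, hC⟩ := exists_eLpNorm_integralBound_le hp hp'
  have hq := one_lt_toReal hp hp'
  refine ⟨C, fun H hH s f => ?_⟩
  have hρ : AEMeasurable (fun t => ‖H t‖ₑ + ‖deriv H t‖ₑ) :=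
    hH.integrable.aestronglyMeasurable.enorm.add hH.integrable_deriv.aestronglyMeasurable.enorm
  -- With this measure Minkowski's inequality yields the total mass times a bound uniform in t.
  set ν : Measure ℝ := volume.withDensity fun t => ‖H t‖ₑ + ‖deriv H t‖ₑ with hν
  have hν1 : ν Set.univ = ∫⁻ t, (‖H t‖ₑ + ‖deriv H t‖ₑ) := by
    rw [hν, withDensity_apply _ MeasurableSet.univ, Measure.restrict_univ]
  have hm : ∀ n, Measurable fun t => ENNReal.ofReal (integralBound s f t n) := fun n =>
    (continuous_integralBound s f n).measurable.ennreal_ofReal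
  set Y : ℤ → ℝ≥0∞ := fun n => ∫⁻ t, ENNReal.ofReal (integralBound s f t n) ∂ν with hY
  have hYle : eLpNorm Y p Measure.count ≤ ν Set.univ * (C * eLpNorm f p Measure.count) := by
    rw [eLpNorm_count_le_iff hp hp']
    refine tsum_lintegral_rpow_le ν hq (fun t n => ENNReal.ofReal (integralBound s f t n))
      (fun n => (hm n).aemeasurable) _ fun t => ?_
    have h := (eLpNorm_count_le_iff hp hp' _ _).1 (hC s f t)
    refine le_trans (le_of_eq (tsum_congr fun n => ?_)) h
    rw [← ofReal_norm, Real.norm_of_nonneg (integralBound_nonneg s f t n)]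
  rw [← eLpNorm_comp_floor] at hYle
  calc _ ≤ eLpNorm (fun x : ℝ => Y ⌊x⌋) p volume := by
        refine eLpNorm_mono_enorm fun x => ?_
        rw [enorm_eq_self, hY, hν]
        simp only
        rw [lintegral_withDensity_eq_lintegral_mul₀ hρ (hm _).aemeasurable]
        exact hH.enorm_sum_fourierInv_le s f x
    _ ≤ _ := hYle.trans (le_of_eq (by rw [hν1]; ring))

/-! ### Periodization and the symbol of the fundamental function. -/

/-- The decay hypothesis acts outside a ball; inside it, away from 0, continuity on a compact set
suffices. -/
lemma exists_abs_le_of_decay {G : ℝ → ℝ} {ε : ℝ} (hε : 0 < ε) (hG : ContinuousOn G {0}ᶜ)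
    (hdec : G =O[Filter.cocompact ℝ] fun ξ => |ξ| ^ (-(1 + ε))) {δ : ℝ} (hδ : 0 < δ) :
    ∃ C, 0 ≤ C ∧ ∀ ξ, δ ≤ |ξ| → |G ξ| ≤ C * |ξ| ^ (-(1 + ε)) := by
  obtain ⟨c, hc⟩ := hdec.bound
  obtain ⟨K, hK, hKc⟩ := Filter.mem_cocompact.1 hc
  obtain ⟨R, hR⟩ := hK.isBounded.subset_closedBall 0
  set T : Set ℝ := Metric.closedBall 0 R ∩ {ξ | δ ≤ |ξ|} with hT
  have hTc : IsCompact T := (isCompact_closedBall 0 R).inter_right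
    (isClosed_le continuous_const continuous_abs)
  have hT0 : ∀ ξ ∈ T, ξ ≠ 0 := fun ξ hξ h => by
    have : δ ≤ |ξ| := hξ.2
    rw [h, abs_zero] at this
    linarith
  have hcont : ContinuousOn (fun ξ => G ξ * |ξ| ^ (1 + ε)) T := by
    refine (hG.mono fun ξ hξ => hT0 ξ hξ).mul (Continuous.continuousOn ?_)
    exact continuous_abs.rpow_const fun _ => Or.inr (by linarith)
  obtain ⟨M, hM⟩ := hTc.exists_bound_of_continuousOn hcont
  refine ⟨max (max c M) 0, le_max_right _ _, fun ξ hξ => ?_⟩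
  have hξ0 : 0 < |ξ| := hδ.trans_le hξ
  have hpos : 0 < |ξ| ^ (-(1 + ε)) := Real.rpow_pos_of_pos hξ0 _
  by_cases h : ξ ∈ Metric.closedBall (0 : ℝ) R
  · have h1 := hM ξ ⟨h, hξ⟩
    rw [Real.norm_eq_abs, abs_mul, abs_of_pos (Real.rpow_pos_of_pos hξ0 _)] at h1
    have h2 : |G ξ| = |G ξ| * |ξ| ^ (1 + ε) * |ξ| ^ (-(1 + ε)) := by
      rw [mul_assoc, ← Real.rpow_add hξ0, add_neg_cancel, Real.rpow_zero, mul_one]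
    rw [h2]
    exact mul_le_mul_of_nonneg_right (h1.trans ((le_max_right _ _).trans (le_max_left _ _))) hpos.le
  · have h1 : ξ ∈ {x | ‖G x‖ ≤ c * ‖|x| ^ (-(1 + ε))‖} := hKc fun hk => h (hR hk)
    simp only [Set.mem_ofPred_eq, Real.norm_eq_abs, abs_of_pos hpos] at h1
    exact h1.trans (mul_le_mul_of_nonneg_right ((le_max_left _ _).trans (le_max_left _ _)) hpos.le)

/-- Away from `2πℤ`, the periodization of a decaying function converges locally uniformly. -/
lemma exists_summable_bound {G : ℝ → ℝ} {ε : ℝ} (hε : 0 < ε) (hG : ContinuousOn G {0}ᶜ)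
    (hdec : G =O[Filter.cocompact ℝ] fun ξ => |ξ| ^ (-(1 + ε))) {ξ₀ : ℝ}
    (hξ₀ : ∀ k : ℤ, ξ₀ ≠ 2 * Real.pi * k) :
    ∃ δ > 0, ∃ u : ℤ → ℝ, Summable u ∧ ∀ ξ ∈ Metric.ball ξ₀ δ, ∀ j : ℤ,
      ξ + 2 * Real.pi * j ≠ 0 ∧ |G (ξ + 2 * Real.pi * j)| ≤ u j := by
  have hπ := Real.two_pi_pos
  set y := ξ₀ / (2 * Real.pi) with hy
  have hξy : ξ₀ = 2 * Real.pi * y := by rw [hy]; field_simp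
  -- Half the distance from `ξ₀` to 2πℤ. Hence points within δ of `ξ₀` satisfy `|ξ + 2πj| ≥ π|j +
  -- y|`, the source of the majorant.
  set δ := Real.pi * |y - round y| with hδ
  have hδ0 : 0 < δ := by
    refine mul_pos Real.pi_pos (abs_pos.2 fun h => hξ₀ (round y) ?_)
    rw [hξy, sub_eq_zero.1 h, round_intCast]
  have hfar : ∀ j : ℤ, 2 * δ ≤ |ξ₀ + 2 * Real.pi * j| := by
    intro j
    have h1 := round_le y (-j)
    have h2 : ξ₀ + 2 * Real.pi * j = 2 * Real.pi * (y - (-j : ℤ)) := by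
      rw [hξy]; push_cast; ring
    rw [h2, abs_mul, abs_of_pos hπ, hδ]
    nlinarith [Real.pi_pos]
  obtain ⟨C, hC0, hC⟩ := exists_abs_le_of_decay hε hG hdec hδ0
  refine ⟨δ, hδ0, fun j => C * (Real.pi ^ (-(1 + ε)) * (1 / |(j : ℝ) + y| ^ (1 + ε))), ?_, ?_⟩
  · exact ((Real.summable_one_div_int_add_rpow y (1 + ε)).2 (by linarith)).mul_left _ |>.mul_left _
  · intro ξ hξ j
    rw [Metric.mem_ball, Real.dist_eq] at hξ
    have h1 := hfar j
    have h2 : |ξ₀ + 2 * Real.pi * j| ≤ |ξ + 2 * Real.pi * j| + |ξ - ξ₀| := by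
      have := abs_sub_abs_le_abs_sub (ξ₀ + 2 * Real.pi * j) (ξ + 2 * Real.pi * j)
      rw [show ξ₀ + 2 * Real.pi * j - (ξ + 2 * Real.pi * j) = -(ξ - ξ₀) by ring, abs_neg] at this
      linarith
    have h3 : |ξ₀ + 2 * Real.pi * j| = 2 * Real.pi * |(j : ℝ) + y| := by
      rw [hξy, ← mul_add, abs_mul, abs_of_pos hπ, add_comm]
    have h4 : 0 < |(j : ℝ) + y| := by
      have : 0 < 2 * Real.pi * |(j : ℝ) + y| := by rw [← h3]; linarith
      exact pos_of_mul_pos_right this hπ.le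
    have h5 : δ ≤ |ξ + 2 * Real.pi * j| := by linarith
    refine ⟨fun h => by rw [h, abs_zero] at h5; linarith, (hC _ h5).trans ?_⟩
    refine mul_le_mul_of_nonneg_left ?_ hC0
    rw [one_div, ← Real.rpow_neg h4.le, ← Real.mul_rpow Real.pi_pos.le h4.le]
    refine Real.rpow_le_rpow_of_nonpos (by positivity) ?_ (by linarith)
    linarith

/-- The periodization `∑ j, F (ξ + 2πj)`. -/
noncomputable def periodization (F : ℝ → ℝ) (ξ : ℝ) : ℝ := ∑' j : ℤ, F (ξ + 2 * Real.pi * j)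

lemma periodization_add (F : ℝ → ℝ) (ξ : ℝ) (k : ℤ) :
    periodization F (ξ + 2 * Real.pi * k) = periodization F ξ := by
  unfold periodization
  rw [← (Equiv.addRight k).tsum_eq fun j : ℤ => F (ξ + 2 * Real.pi * j)]
  refine tsum_congr fun j => ?_
  congr 1
  simp
  ring

section

variable {φ F : ℝ → ℝ}

lemma InterpolatingConditions.continuousOn (h : InterpolatingConditions φ F) :
    ContinuousOn F {0}ᶜ := h.contDiff.continuousOn

lemma InterpolatingConditions.continuousOn_deriv (h : InterpolatingConditions φ F) :
    ContinuousOn (deriv F) {0}ᶜ :=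
  h.contDiff.continuousOn_deriv_of_isOpen isOpen_compl_singleton le_rfl

lemma InterpolatingConditions.differentiableAt (h : InterpolatingConditions φ F) {ξ : ℝ}
    (hξ : ξ ≠ 0) : DifferentiableAt ℝ F ξ :=
  (h.contDiff.differentiableOn one_ne_zero).differentiableAt (isOpen_compl_singleton.mem_nhds hξ)

lemma InterpolatingConditions.measurable (h : InterpolatingConditions φ F) : Measurable F :=
  measurable_of_continuousOn_compl_singleton 0 h.continuousOn

lemma add_two_pi_mul_ne_zero {ξ : ℝ} (hξ : ∀ k : ℤ, ξ ≠ 2 * Real.pi * k) (j : ℤ) :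
    ξ + 2 * Real.pi * j ≠ 0 := fun h => hξ (-j) (by push_cast; linarith)

lemma InterpolatingConditions.summable (h : InterpolatingConditions φ F) {ξ : ℝ}
    (hξ : ∀ k : ℤ, ξ ≠ 2 * Real.pi * k) : Summable fun j : ℤ => F (ξ + 2 * Real.pi * j) := by
  obtain ⟨ε, hε, hF, -⟩ := h.decay
  obtain ⟨δ, hδ, u, hu, hb⟩ := exists_summable_bound hε h.continuousOn hF hξ
  exact Summable.of_norm_bounded hu fun j => (hb ξ (Metric.mem_ball_self hδ) j).2

lemma InterpolatingConditions.summable_deriv (h : InterpolatingConditions φ F) {ξ : ℝ}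
    (hξ : ∀ k : ℤ, ξ ≠ 2 * Real.pi * k) : Summable fun j : ℤ => deriv F (ξ + 2 * Real.pi * j) := by
  obtain ⟨ε, hε, -, hF⟩ := h.decay
  obtain ⟨δ, hδ, u, hu, hb⟩ := exists_summable_bound hε h.continuousOn_deriv hF hξ
  exact Summable.of_norm_bounded hu fun j => (hb ξ (Metric.mem_ball_self hδ) j).2

lemma InterpolatingConditions.hasDerivAt_periodization (h : InterpolatingConditions φ F) {ξ : ℝ}
    (hξ : ∀ k : ℤ, ξ ≠ 2 * Real.pi * k) :
    HasDerivAt (periodization F) (periodization (deriv F) ξ) ξ := by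
  obtain ⟨ε, hε, -, hF⟩ := h.decay
  obtain ⟨δ, hδ, u, hu, hb⟩ := exists_summable_bound hε h.continuousOn_deriv hF hξ
  have hd : ∀ (j : ℤ), ∀ y ∈ Metric.ball ξ δ, HasDerivAt (fun y => F (y + 2 * Real.pi * j))
      (deriv F (y + 2 * Real.pi * j)) y := fun j y hy =>
    (h.differentiableAt (hb y hy j).1).hasDerivAt.comp_add_const y (2 * Real.pi * j)
  have hξδ : ξ ∈ Metric.ball ξ δ := Metric.mem_ball_self hδ
  exact hasDerivAt_tsum_of_isPreconnected hu Metric.isOpen_ball (convex_ball ξ δ).isPreconnected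
    hd (fun j y hy => (hb y hy j).2) hξδ (h.summable hξ) hξδ

lemma InterpolatingConditions.le_periodization (h : InterpolatingConditions φ F) {ξ : ℝ}
    (hξ : ∀ k : ℤ, ξ ≠ 2 * Real.pi * k) (j : ℤ) :
    F (ξ + 2 * Real.pi * j) ≤ periodization F ξ :=
  (h.summable hξ).le_tsum j fun i _ => h.nonneg _ (add_two_pi_mul_ne_zero hξ i)

lemma InterpolatingConditions.pos (h : InterpolatingConditions φ F) {ξ : ℝ} (hξ : ξ ≠ 0)
    (hξ' : |ξ| ≤ Real.pi) : 0 < F ξ := by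
  obtain ⟨m, hm, hF⟩ := h.bounded_below
  exact hm.trans_le (hF ξ (abs_le.1 hξ') hξ)

/-- One translate falls in `[-π, π]`, where F is bounded below. -/
lemma InterpolatingConditions.periodization_pos (h : InterpolatingConditions φ F) {ξ : ℝ}
    (hξ : ∀ k : ℤ, ξ ≠ 2 * Real.pi * k) : 0 < periodization F ξ := by
  set y := ξ / (2 * Real.pi) with hy
  have hξy : ξ = 2 * Real.pi * y := by rw [hy]; field_simp
  refine (h.pos (add_two_pi_mul_ne_zero hξ (-round y)) ?_).trans_le (h.le_periodization hξ _)
  have h1 : ξ + 2 * Real.pi * ((-round y : ℤ) : ℝ) = 2 * Real.pi * (y - round y) := by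
    rw [hξy]; push_cast; ring
  rw [h1, abs_mul, abs_of_pos Real.two_pi_pos]
  nlinarith [abs_sub_round y, Real.pi_pos]

lemma fundamentalHat_eq (F : ℝ → ℝ) :
    fundamentalHat F = fun ξ => (Real.sqrt (2 * Real.pi))⁻¹ * (F ξ / periodization F ξ) := rfl

lemma InterpolatingConditions.hasDerivAt_fundamentalHat (h : InterpolatingConditions φ F) {ξ : ℝ}
    (hξ : ∀ k : ℤ, ξ ≠ 2 * Real.pi * k) :
    HasDerivAt (fundamentalHat F) ((Real.sqrt (2 * Real.pi))⁻¹ *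
      ((deriv F ξ * periodization F ξ - F ξ * periodization (deriv F) ξ) /
        periodization F ξ ^ 2)) ξ := by
  rw [fundamentalHat_eq]
  have h0 : ξ ≠ 0 := by simpa using hξ 0
  exact ((h.differentiableAt h0).hasDerivAt.div (h.hasDerivAt_periodization hξ)
    (h.periodization_pos hξ).ne').const_mul _

lemma ne_two_pi_mul_add {ξ : ℝ} (hξ : ∀ k : ℤ, ξ ≠ 2 * Real.pi * k) (j k : ℤ) :
    ξ + 2 * Real.pi * j ≠ 2 * Real.pi * k := fun h => hξ (k - j) (by push_cast; linarith)

lemma inv_sqrt_two_pi_le : (Real.sqrt (2 * Real.pi))⁻¹ ≤ 1 := by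
  refine inv_le_one_of_one_le₀ ?_
  rw [Real.one_le_sqrt]
  nlinarith [Real.pi_gt_three]

lemma enorm_inv_sqrt_two_pi_mul_le (x : ℝ) : ‖(Real.sqrt (2 * Real.pi))⁻¹ * x‖ₑ ≤ ‖x‖ₑ := by
  rw [enorm_le_iff_norm_le, norm_mul, Real.norm_of_nonneg (by positivity)]
  exact mul_le_of_le_one_left (norm_nonneg _) inv_sqrt_two_pi_le

/-- The translates of F/S form a partition of unity; the factor `(2π)^(-1/2) ≤ 1` is discarded. -/
lemma InterpolatingConditions.tsum_enorm_fundamentalHat_le (h : InterpolatingConditions φ F) {ξ : ℝ}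
    (hξ : ∀ k : ℤ, ξ ≠ 2 * Real.pi * k) :
    ∑' j : ℤ, ‖fundamentalHat F (ξ + 2 * Real.pi * j)‖ₑ ≤ 1 := by
  have hS := h.periodization_pos hξ
  calc ∑' j : ℤ, ‖fundamentalHat F (ξ + 2 * Real.pi * j)‖ₑ
      ≤ ∑' j : ℤ, ENNReal.ofReal (F (ξ + 2 * Real.pi * j) / periodization F ξ) := by
        refine ENNReal.tsum_le_tsum fun j => ?_
        refine (enorm_inv_sqrt_two_pi_mul_le _).trans (le_of_eq ?_)
        change ‖F (ξ + 2 * Real.pi * j) / periodization F (ξ + 2 * Real.pi * j)‖ₑ = _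
        rw [periodization_add, ← ofReal_norm, Real.norm_of_nonneg
          (div_nonneg (h.nonneg _ (add_two_pi_mul_ne_zero hξ j)) hS.le)]
    _ = 1 := by
        rw [← ENNReal.ofReal_tsum_of_nonneg (fun j =>
          div_nonneg (h.nonneg _ (add_two_pi_mul_ne_zero hξ j)) hS.le) ((h.summable hξ).div_const _),
          tsum_div_const, ← periodization, div_self hS.ne', ENNReal.ofReal_one]

/-- In the quotient rule the terms with `k = j` cancel, leaving off-diagonal products over `S²`. As
`S ≥ F ξ > 0`, replacing S by `F ξ` only enlarges them and produces the quotients `aux`. -/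
lemma InterpolatingConditions.enorm_deriv_fundamentalHat_le (h : InterpolatingConditions φ F)
    {ξ : ℝ} (hξ : ∀ k : ℤ, ξ ≠ 2 * Real.pi * k) (hξ' : |ξ| ≤ Real.pi) (j : ℤ) :
    ‖deriv (fundamentalHat F) (ξ + 2 * Real.pi * j)‖ₑ ≤
      ∑' k : {k : ℤ // k ≠ j}, (‖aux F F k ξ * aux (deriv F) F j ξ‖ₑ +
        ‖aux F F j ξ * aux (deriv F) F k ξ‖ₑ) := by
  have h0 : ξ ≠ 0 := by simpa using hξ 0
  have hF : 0 < F ξ := h.pos h0 hξ'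
  have hS := h.periodization_pos hξ
  have hFS : F ξ ≤ periodization F ξ := by simpa using h.le_periodization hξ 0
  have s1 := h.summable hξ
  have s2 := h.summable_deriv hξ
  rw [(h.hasDerivAt_fundamentalHat (ne_two_pi_mul_add hξ j)).deriv, periodization_add,
    periodization_add]
  refine (enorm_inv_sqrt_two_pi_mul_le _).trans ?_
  set f : ℤ → ℝ := fun k => F (ξ + 2 * Real.pi * k)
  set f' : ℤ → ℝ := fun k => deriv F (ξ + 2 * Real.pi * k)
  have hsum : deriv F (ξ + 2 * Real.pi * j) * periodization F ξ -
      F (ξ + 2 * Real.pi * j) * periodization (deriv F) ξ = ∑' k : ℤ, (f' j * f k - f j * f' k) := by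
    rw [(s1.mul_left _).tsum_sub (s2.mul_left _), tsum_mul_left, tsum_mul_left]
    rfl
  have hsupp : ∑' k : ℤ, (f' j * f k - f j * f' k) =
      ∑' k : {k : ℤ // k ≠ j}, (f' j * f k - f j * f' k) := by
    refine (tsum_subtype_eq_of_support_subset (s := {k | k ≠ j}) ?_).symm
    intro k hk hkj
    apply hk
    have hkj' : k = j := by simpa using hkj
    rw [hkj']; ring
  rw [hsum, hsupp, ← tsum_div_const]
  refine (enorm_tsum_le_tsum_enorm).trans (ENNReal.tsum_le_tsum fun k => ?_)
  have e : aux F F k ξ * aux (deriv F) F j ξ = f' j * f k / F ξ ^ 2 := by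
    simp only [aux, f, f']; field_simp
  have e' : aux F F j ξ * aux (deriv F) F k ξ = f j * f' k / F ξ ^ 2 := by
    simp only [aux, f, f']; field_simp
  rw [e, e']
  calc ‖(f' j * f k - f j * f' k) / periodization F ξ ^ 2‖ₑ
      ≤ ‖(f' j * f k - f j * f' k) / F ξ ^ 2‖ₑ := by
        rw [enorm_le_iff_norm_le, norm_div, norm_div, norm_pow, norm_pow, Real.norm_of_nonneg hF.le,
          Real.norm_of_nonneg hS.le]
        gcongr
    _ ≤ _ := by rw [sub_div]; exact enorm_sub_le

end

/-! ### L¹ bounds for the symbol and its derivative. -/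

/-- Lebesgue integrals over `ℝ` by periodization. -/
lemma lintegral_eq_lintegral_tsum (g : ℝ → ℝ≥0∞) (hg : AEMeasurable g) :
    ∫⁻ t, g t = ∫⁻ u in Set.Ioc (-Real.pi) Real.pi, ∑' j : ℤ, g (u + 2 * Real.pi * j) := by
  have hdisj : Pairwise (Function.onFun Disjoint fun k : ℤ =>
      Set.Ioc (-Real.pi + 2 * Real.pi * k) (Real.pi + 2 * Real.pi * k)) := by
    have h := Set.pairwise_disjoint_Ioc_add_zsmul (-Real.pi) (2 * Real.pi)
    intro i j hij
    have := h hij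
    simp only [Function.onFun] at this ⊢
    convert! this using 2 <;> simp <;> ring
  have hun : ⋃ k : ℤ, Set.Ioc (-Real.pi + 2 * Real.pi * k) (Real.pi + 2 * Real.pi * k) =
      Set.univ := by
    rw [← iUnion_Ioc_add_zsmul Real.two_pi_pos (-Real.pi)]
    refine Set.iUnion_congr fun k => ?_
    congr 1 <;> simp <;> ring
  rw [lintegral_tsum, ← setLIntegral_univ g, ← hun, lintegral_iUnion (fun _ => measurableSet_Ioc) hdisj]
  · refine tsum_congr fun k => ?_
    rw [← (measurePreserving_add_right volume (2 * Real.pi * (k : ℝ))).setLIntegral_comp_preimage_emb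
      (measurableEmbedding_addRight _)]
    simp
  · intro j
    exact ((hg.comp_quasiMeasurePreserving (measurePreserving_add_right volume
      (2 * Real.pi * (j : ℝ))).quasiMeasurePreserving)).restrict

lemma countable_two_pi_mul : {t : ℝ | ∃ k : ℤ, t = 2 * Real.pi * k}.Countable := by
  refine (Set.countable_range fun k : ℤ => 2 * Real.pi * (k : ℝ)).mono ?_
  rintro t ⟨k, rfl⟩
  exact ⟨k, rfl⟩

lemma ae_ne_two_pi_mul : ∀ᵐ t : ℝ, ∀ k : ℤ, t ≠ 2 * Real.pi * k := by
  filter_upwards [countable_two_pi_mul.ae_notMem volume] with t ht k hk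
  exact ht ⟨k, hk⟩

section

variable {φ F : ℝ → ℝ}

lemma InterpolatingConditions.aestronglyMeasurable_fundamentalHat
    (h : InterpolatingConditions φ F) : AEStronglyMeasurable (fundamentalHat F) volume := by
  set U : Set ℝ := {t : ℝ | ∃ k : ℤ, t = 2 * Real.pi * k}ᶜ
  have hU : MeasurableSet U := countable_two_pi_mul.measurableSet.compl
  have hc : ContinuousOn (fundamentalHat F) U := fun t ht =>
    (h.hasDerivAt_fundamentalHat fun k hk => ht ⟨k, hk⟩).continuousAt.continuousWithinAt
  have := hc.aestronglyMeasurable (μ := volume) hU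
  have hae : ∀ᵐ t : ℝ, t ∈ U := countable_two_pi_mul.ae_notMem volume
  rwa [Measure.restrict_eq_self_of_ae_mem hae] at this

lemma InterpolatingConditions.lintegral_fundamentalHat_le (h : InterpolatingConditions φ F) :
    ∫⁻ t, ‖fundamentalHat F t‖ₑ ≤ ENNReal.ofReal (2 * Real.pi) := by
  rw [lintegral_eq_lintegral_tsum _ h.aestronglyMeasurable_fundamentalHat.enorm]
  calc _ ≤ ∫⁻ _ in Set.Ioc (-Real.pi) Real.pi, (1 : ℝ≥0∞) := by
        refine lintegral_mono_ae (ae_restrict_of_ae ?_)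
        filter_upwards [ae_ne_two_pi_mul] with u hu
        exact h.tsum_enorm_fundamentalHat_le hu
    _ = _ := by
        rw [lintegral_one, Measure.restrict_apply_univ, Real.volume_Ioc]
        congr 1; ring

lemma tsum_subtype_ne_comm (b : ℤ → ℤ → ℝ≥0∞) :
    ∑' j : ℤ, ∑' k : {k : ℤ // k ≠ j}, b k j = ∑' j : ℤ, ∑' k : {k : ℤ // k ≠ j}, b j k := by
  have e : ∀ (c : ℤ → ℝ≥0∞) (j : ℤ), ∑' k : {k : ℤ // k ≠ j}, c k =
      ∑' k : ℤ, if k = j then 0 else c k := by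
    intro c j
    refine (tsum_subtype {k : ℤ | k ≠ j} c).trans (tsum_congr fun k => ?_)
    by_cases h : k = j <;> simp [h]
  rw [tsum_congr fun j => e (fun k => b k j) j, tsum_congr fun j => e (fun k => b j k) j,
    ENNReal.tsum_comm]
  refine tsum_congr fun j => tsum_congr fun k => ?_
  simp only [eq_comm]

/-- The factor 2 arises because the two families of products differ only by exchanging j and k, and
the off-diagonal sum is symmetric. -/
lemma InterpolatingConditions.lintegral_deriv_fundamentalHat_le (h : InterpolatingConditions φ F) :
    ∫⁻ t, ‖deriv (fundamentalHat F) t‖ₑ ≤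
      2 * ∑' j : ℤ, ∑' k : {k : ℤ // k ≠ j}, ∫⁻ ξ in Set.Icc (-Real.pi) Real.pi,
        ‖aux F F j ξ * aux (deriv F) F k ξ‖ₑ := by
  have hF := h.measurable
  have hF' := measurable_deriv F
  have ma : ∀ k, Measurable (aux F F k) := fun k => by unfold aux; fun_prop
  have ma' : ∀ k, Measurable (aux (deriv F) F k) := fun k => by unfold aux; fun_prop
  have mb : ∀ j k, Measurable fun ξ => ‖aux F F j ξ * aux (deriv F) F k ξ‖ₑ :=
    fun j k => ((ma j).mul (ma' k)).enorm
  rw [lintegral_eq_lintegral_tsum _ (measurable_deriv _).enorm.aemeasurable]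
  calc _ ≤ ∫⁻ ξ in Set.Ioc (-Real.pi) Real.pi, ∑' j : ℤ, ∑' k : {k : ℤ // k ≠ j},
          (‖aux F F k ξ * aux (deriv F) F j ξ‖ₑ + ‖aux F F j ξ * aux (deriv F) F k ξ‖ₑ) := by
        refine lintegral_mono_ae ?_
        filter_upwards [ae_restrict_of_ae ae_ne_two_pi_mul, ae_restrict_mem measurableSet_Ioc]
          with ξ hξ hξ'
        exact ENNReal.tsum_le_tsum fun j =>
          h.enorm_deriv_fundamentalHat_le hξ (abs_le.2 ⟨hξ'.1.le, hξ'.2⟩) j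
    _ ≤ ∫⁻ ξ in Set.Icc (-Real.pi) Real.pi, ∑' j : ℤ, ∑' k : {k : ℤ // k ≠ j},
          (‖aux F F k ξ * aux (deriv F) F j ξ‖ₑ + ‖aux F F j ξ * aux (deriv F) F k ξ‖ₑ) :=
        lintegral_mono_set Set.Ioc_subset_Icc_self
    _ = ∑' j : ℤ, ∑' k : {k : ℤ // k ≠ j}, ((∫⁻ ξ in Set.Icc (-Real.pi) Real.pi,
          ‖aux F F k ξ * aux (deriv F) F j ξ‖ₑ) + ∫⁻ ξ in Set.Icc (-Real.pi) Real.pi,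
          ‖aux F F j ξ * aux (deriv F) F k ξ‖ₑ) := by
        have mc : ∀ j k, Measurable fun ξ => ‖aux F F k ξ * aux (deriv F) F j ξ‖ₑ +
            ‖aux F F j ξ * aux (deriv F) F k ξ‖ₑ := fun j k => (mb k j).add (mb j k)
        rw [lintegral_tsum fun j => (Measurable.tsum fun k : {k : ℤ // k ≠ j} =>
          mc j k).aemeasurable]
        refine tsum_congr fun j => ?_
        rw [lintegral_tsum fun k : {k : ℤ // k ≠ j} => (mc j k).aemeasurable]
        exact tsum_congr fun k => lintegral_add_left (mb k j) _
    _ = _ := by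
        simp only [ENNReal.tsum_add]
        rw [tsum_subtype_ne_comm fun j k => ∫⁻ ξ in Set.Icc (-Real.pi) Real.pi,
          ‖aux F F j ξ * aux (deriv F) F k ξ‖ₑ, two_mul]

lemma InterpolatingConditions.integrable_fundamentalHat (h : InterpolatingConditions φ F) :
    Integrable (fundamentalHat F) :=
  ⟨h.aestronglyMeasurable_fundamentalHat,
    h.lintegral_fundamentalHat_le.trans_lt ENNReal.ofReal_lt_top⟩

lemma InterpolatingConditions.piecewiseBV_fundamentalHat (h : InterpolatingConditions φ F)
    (hC : ∑' j : ℤ, ∑' k : {k : ℤ // k ≠ j}, ∫⁻ ξ in Set.Icc (-Real.pi) Real.pi,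
      ‖aux F F j ξ * aux (deriv F) F k ξ‖ₑ ≠ ∞) : PiecewiseBV (fundamentalHat F) where
  integrable := h.integrable_fundamentalHat
  integrable_deriv := ⟨(measurable_deriv _).aestronglyMeasurable,
    h.lintegral_deriv_fundamentalHat_le.trans_lt (ENNReal.mul_lt_top (by simp) hC.lt_top)⟩
  bounded := by
    refine ⟨1, fun t ht => ?_⟩
    have h1 := (ENNReal.le_tsum 0).trans (h.tsum_enorm_fundamentalHat_le ht)
    rw [Int.cast_zero, mul_zero, add_zero, ← ofReal_norm, ← ENNReal.ofReal_one,
      ENNReal.ofReal_le_ofReal_iff zero_le_one] at h1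
    exact h1
  differentiableAt t ht := (h.hasDerivAt_fundamentalHat ht).differentiableAt

end

/-! ### Convergence of the series and conclusion. -/

lemma summable_rpow_norm_inv_sub_add_I {q : ℝ} (hq : 1 < q) (x : ℝ) :
    Summable fun j : ℤ => (‖(x : ℂ) - j + Complex.I‖⁻¹) ^ q := by
  have h1 := (Real.summable_one_div_int_add_rpow (-x) q).2 hq
  refine Summable.of_norm_bounded_eventually h1 ?_
  have hfin : {j : ℤ | (j : ℝ) = x}.Finite := by
    refine Set.Subsingleton.finite fun i hi j hj => ?_
    exact_mod_cast (hi.trans hj.symm : (i : ℝ) = j)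
  filter_upwards [hfin.compl_mem_cofinite] with j hj
  have hj0 : 0 < |(j : ℝ) + -x| := abs_pos.2 fun h => hj (by
    change (j : ℝ) = x
    linarith)
  have h2 : |(j : ℝ) + -x| ≤ ‖(x : ℂ) - j + Complex.I‖ := by
    refine le_trans (le_of_eq ?_) (Complex.abs_re_le_norm _)
    simp [← abs_neg (x - j : ℝ)]
    ring_nf
  rw [Real.norm_of_nonneg (by positivity), Real.inv_rpow (norm_nonneg _), one_div]
  gcongr

lemma PiecewiseBV.summable_mul_fourierInv {H : ℝ → ℝ} (hH : PiecewiseBV H) {p : ℝ≥0∞} (hp : 1 < p)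
    (hp' : p < ∞) (f : lp (fun _ : ℤ => ℂ) p) (x : ℝ) :
    Summable fun j : ℤ => f j * fourierInv (fun ξ => (H ξ : ℂ)) (x - j) := by
  have hq := one_lt_toReal hp hp'
  obtain ⟨C, hC⟩ := hH.norm_fourierInv_le
  have hqr : p.toReal.HolderConjugate (p.toReal / (p.toReal - 1)) :=
    Real.HolderConjugate.conjExponent hq
  have hf : Summable fun j => ‖f j‖ ^ p.toReal := (lp.memℓp f).summable (by linarith)
  have h1 := Real.summable_mul_of_Lp_Lq_of_nonneg hqr (f := fun j => ‖f j‖)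
    (g := fun j : ℤ => ‖(x : ℂ) - j + Complex.I‖⁻¹) (fun j => norm_nonneg _)
    (fun j => by positivity) hf (summable_rpow_norm_inv_sub_add_I hqr.symm.lt x)
  refine Summable.of_norm_bounded (h1.mul_left C) fun j => ?_
  have h2 := hC (x - j)
  push_cast at h2
  rw [norm_mul]
  calc _ ≤ ‖f j‖ * (C / ‖(x : ℂ) - j + Complex.I‖) := by gcongr
    _ = _ := by ring

lemma eLpNorm_count_lp {p : ℝ≥0∞} (hp : 1 < p) (hp' : p < ∞) (f : lp (fun _ : ℤ => ℂ) p) :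
    eLpNorm (fun j => f j) p Measure.count = ENNReal.ofReal ‖f‖ := by
  have hq := one_lt_toReal hp hp'
  have hf : Summable fun j => ‖f j‖ ^ p.toReal := (lp.memℓp f).summable (by linarith)
  rw [eLpNorm_eq_lintegral_rpow_enorm_toReal (by positivity) hp'.ne, lintegral_count,
    lp.norm_eq_tsum_rpow (by linarith), ← ENNReal.ofReal_rpow_of_nonneg
      (tsum_nonneg fun j => by positivity) (by positivity),
    ENNReal.ofReal_tsum_of_nonneg (fun j => by positivity) hf]
  congr 1
  refine tsum_congr fun j => ?_
  rw [← ENNReal.ofReal_rpow_of_nonneg (norm_nonneg _) (by linarith), ofReal_norm]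

end CardinalInterpolation

open CardinalInterpolation

theorem proposition1 (A : Set ℝ) (hA_pos : A ⊆ Set.Ioi 0) (hA_unbdd : ¬ BddAbove A)
    (φ φhat : ℝ → ℝ → ℝ) (hφ : CardinalInterpolation.SplineLikeFamily A φ φhat)
    (p : ℝ≥0∞) (hp_one : 1 < p) (hp_top : p < ∞) :
    (∀ α ∈ A, MeasureTheory.Integrable (CardinalInterpolation.fundamentalHat (φhat α))) ∧
    ∃ C : ℝ≥0, ∀ α ∈ A, ∀ f : lp (fun _ : ℤ => ℂ) p,
      (∀ x : ℝ, Summable fun j : ℤ =>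
        f j * CardinalInterpolation.fundamental (φhat α) (x - j)) ∧
      MeasureTheory.MemLp (CardinalInterpolation.interpolant (φhat α) f) p ∧
      MeasureTheory.eLpNorm (CardinalInterpolation.interpolant (φhat α) f) p
        MeasureTheory.volume ≤ C * ENNReal.ofReal ‖f‖ := by
  refine ⟨fun α hα => (hφ.interpolating α hα).integrable_fundamentalHat, ?_⟩
  obtain ⟨B, hB⟩ := hφ.sum_bound
  obtain ⟨C, hC⟩ := exists_eLpNorm_sum_fourierInv_le hp_one hp_top
  -- The multiplier constant times the uniform bounds 2π for the symbol and `2B` for its derivative.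
  refine ⟨C * ((2 * Real.pi).toNNReal + 2 * B), fun α hα f => ?_⟩
  have hI := hφ.interpolating α hα
  have hBV : PiecewiseBV (fundamentalHat (φhat α)) :=
    hI.piecewiseBV_fundamentalHat ((hB α hα).trans_lt ENNReal.coe_lt_top).ne
  have hV : ∫⁻ t, (‖fundamentalHat (φhat α) t‖ₑ + ‖deriv (fundamentalHat (φhat α)) t‖ₑ) ≤
      (((2 * Real.pi).toNNReal + 2 * B : ℝ≥0) : ℝ≥0∞) := by
    rw [MeasureTheory.lintegral_add_left' hBV.integrable.aestronglyMeasurable.enorm]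
    push_cast
    exact add_le_add hI.lintegral_fundamentalHat_le
      (hI.lintegral_deriv_fundamentalHat_le.trans (mul_le_mul_right (hB α hα) 2))
  have hsum : ∀ x : ℝ, Summable fun j : ℤ => f j * fundamental (φhat α) (x - j) := fun x =>
    hBV.summable_mul_fourierInv hp_one hp_top f x
  have hcont : Continuous (fundamental (φhat α)) := continuous_fourierInv hBV.integrable
  have hpart : ∀ s : Finset ℤ, MeasureTheory.AEStronglyMeasurable
      (fun x : ℝ => ∑ j ∈ s, f j * fundamental (φhat α) (x - j)) MeasureTheory.volume := fun s =>
    Continuous.aestronglyMeasurable (by fun_prop)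
  have hlim : ∀ᵐ x : ℝ, Filter.Tendsto
      (fun s : Finset ℤ => ∑ j ∈ s, f j * fundamental (φhat α) (x - j)) Filter.atTop
      (nhds (interpolant (φhat α) f x)) := Filter.Eventually.of_forall fun x => (hsum x).hasSum
  have hle : MeasureTheory.eLpNorm (interpolant (φhat α) f) p MeasureTheory.volume ≤
      ((C * ((2 * Real.pi).toNNReal + 2 * B) : ℝ≥0) : ℝ≥0∞) * ENNReal.ofReal ‖f‖ := by
    -- Fatou: the bound is uniform over finite partial sums, which converge pointwise.
    refine MeasureTheory.Lp.eLpNorm_le_of_ae_tendsto (Filter.Eventually.of_forall fun s => ?_)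
      hpart hlim
    refine (hC _ hBV s fun j => f j).trans ?_
    rw [eLpNorm_count_lp hp_one hp_top, ENNReal.coe_mul]
    gcongr
  refine ⟨hsum, ⟨aestronglyMeasurable_of_tendsto_ae Filter.atTop hpart hlim, ?_⟩, hle⟩
  exact hle.trans_lt (ENNReal.mul_lt_top ENNReal.coe_lt_top ENNReal.ofReal_lt_top)
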